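/- Let $I=[a,b]$ with $a\le b$, let $\ell\ge 1$, and let $\mathcal D_I$ be the space of real càdlàg functions on $I$ with Skorohod's $J_1$ topology, metrized by a bounded metric $\delta$; let $\mathrm{Disc}(x)\subset I$ denote the set of discontinuity points of $x$. Equip $\mathcal D_I^\ell$ with the product topology $J_1^\ell$ and a corresponding product metric $\delta_\ell$, and put $\mathrm{Disc}(x)=\bigcup_i \mathrm{Disc}(x_i)$ for $x=(x_1,\dots,x_\ell)$. For a metric space $X$ let $\mathcal M(X)$ be the set of boundedly finite Borel measures on $X$ with the $w^\#$ topology, generated by the maps $\mu\mapsto\int f\,d\mu$ with $f$ bounded continuous with bounded support, and let $\mathcal N(X)\subset\mathcal M(X)$ be the subset of point measures, i.e. those taking integer values on bounded Borel sets. For $X=\mathcal D_I$ or $X=\mathcal D_I^\ell$ let $\mathcal N^*(X)$ be the set of $m\in\mathcal N(X)$ such that $m(\{x,y\})<2$ for all distinct $x,y\in X$ with $\mathrm{Disc}(x)\cap\mathrm{Disc}(y)\neq\emptyset$ (this contains all simple point measures whose atoms have pairwise disjoint sets of discontinuity points). (1) The map $\phi(m)=\int w\,m(dw)$ (pointwise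 integral) is well defined from $\mathcal N(\mathcal D_I)$ to $\mathcal D_I$, and it is continuous, for the $w^\#$ and $J_1$ topologies, at every $m\in\mathcal N^*(\mathcal D_I)$. (2) The map $\Phi(m)=\int w\,m(dw)$ is well defined from $\mathcal N(\mathcal D_I^\ell)$ to $\mathcal D_I^\ell$, and it is continuous, for the $w^\#$ and $J_1^\ell$ topologies, at every $m\in\mathcal N^*(\mathcal D_I^\ell)$. (3) Let $\mathcal S_{I,\ell}=\{x\in\mathcal D_I^\ell:\max_i\sup_{t\in I}|x_i(t)|=1\}$ and let $\mathcal Y=(0,\infty]\times\mathcal S_{I,\ell}$ carry the product metric built from $|1/r-1/r'|$ and $\delta_\ell$. For every $\epsilon>0$ and $m\in\mathcal N(\mathcal Y)$ the truncated sum $\int_{(\epsilon,\infty)}\int_{\mathcal S_{I,\ell}} y\,w\,m(dy,dw)$ is a well-defined element of $\mathcal D_I^\ell$. Let $\mu\in\mathcal M(\mathcal Y)$ and $\epsilon>0$ satisfy $\mu(\{(y,x): t\in\mathrm{Disc}(x)\})=0$ for all $t\in I$ and $\mu(\{\epsilon,\infty\}\times\mathcal S_{I,\ell})=0$. Let $M$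 be a Poisson point process on $\mathcal Y$ with control measure $\mu$, and let $(M_n)$ be a sequence of point processes on $\mathcal Y$ (possibly defined on different probability spaces) converging weakly to $M$ in $\mathcal M(\mathcal Y)$. Then $$\int_{(\epsilon,\infty)}\int_{\mathcal S_{I,\ell}} y\,w\,M_n(dy,dw)\Rightarrow Z:=\int_{(\epsilon,\infty)}\int_{\mathcal S_{I,\ell}} y\,w\,M(dy,dw)$$ weakly in $(\mathcal D_I^\ell,J_1^\ell)$, and the limit has no fixed jump: $P(t\in\mathrm{Disc}(Z))=0$ for all $t\in I$. -/

import Mathlib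

open Set Filter Topology MeasureTheory ProbabilityTheory
open scoped ENNReal NNReal BoundedContinuousFunction

/-- A real function on the compact interval `[a, b]` is càdlàg: right-continuous with
left limits. At the left end point the left limit condition is void. -/
def IsCadlag {a b : ℝ} (f : Icc a b → ℝ) : Prop :=
  ∀ t, ContinuousWithinAt f (Ici t) t ∧ ∃ l : ℝ, Tendsto f (𝓝[<] t) (𝓝 l)

/-- The space `𝒟_I` of real càdlàg functions on `I = [a, b]`. -/
@[ext]
structure Cadlag (a b : ℝ) where
  toFun : Icc a b → ℝ
  isCadlag : IsCadlag toFun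

namespace Cadlag

variable {a b : ℝ}

instance : CoeFun (Cadlag a b) (fun _ => Icc a b → ℝ) := ⟨Cadlag.toFun⟩

theorem isCadlag_zero : IsCadlag (fun _ : Icc a b => (0 : ℝ)) :=
  fun _ => ⟨continuousWithinAt_const, 0, tendsto_const_nhds⟩

instance : Zero (Cadlag a b) := ⟨⟨fun _ => 0, isCadlag_zero⟩⟩

/-- The set of discontinuity points of a càdlàg function. -/
def Disc (x : Cadlag a b) : Set (Icc a b) := {t | ¬ ContinuousAt x t}

open Classical in
/-- A real function regarded as an element of `𝒟_I`; the value is `0` if it is not càdlàg. -/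
noncomputable def ofFun (f : Icc a b → ℝ) : Cadlag a b :=
  if h : IsCadlag f then ⟨f, h⟩ else 0

/-- The numbers `ε ≥ 0` for which some continuous increasing bijection `lam` of `[a, b]` onto
itself satisfies `sup_t |lam t - t| ≤ ε` and `sup_t |x t - y (lam t)| ≤ ε`. -/
def skorokhodBounds (x y : Cadlag a b) : Set ℝ :=
  {ε | 0 ≤ ε ∧ ∃ lam : Icc a b ≃o Icc a b,
    (∀ t, |(lam t : ℝ) - (t : ℝ)| ≤ ε) ∧ ∀ t, |x t - y (lam t)| ≤ ε}

/-- The Skorokhod `J₁` distance truncated at `1`, that is `min (d x y) 1` where `d x y` is the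
infimum over all time changes `lam` of the maximum of the uniform norms of `lam - id` and
of `x - y ∘ lam`. -/
noncomputable def skorokhodDist (x y : Cadlag a b) : ℝ :=
  sInf (insert 1 (skorokhodBounds x y))

theorem bounds_nonneg (x y : Cadlag a b) : ∀ ε ∈ insert 1 (skorokhodBounds x y), 0 ≤ ε := by
  rintro ε (rfl | h)
  · exact zero_le_one
  · exact h.1

theorem bddBelow_bounds (x y : Cadlag a b) : BddBelow (insert 1 (skorokhodBounds x y)) :=
  ⟨0, fun ε h => bounds_nonneg x y ε h⟩

theorem bounds_subset_symm (x y : Cadlag a b) : skorokhodBounds x y ⊆ skorokhodBounds y x := by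
  rintro ε ⟨h0, lam, h1, h2⟩
  refine ⟨h0, lam.symm, fun t => ?_, fun t => ?_⟩
  · have := h1 (lam.symm t)
    rw [OrderIso.apply_symm_apply] at this
    rwa [abs_sub_comm]
  · have := h2 (lam.symm t)
    rw [OrderIso.apply_symm_apply] at this
    rwa [abs_sub_comm]

theorem dist_symm (x y : Cadlag a b) : skorokhodDist x y = skorokhodDist y x := by
  unfold skorokhodDist
  rw [(bounds_subset_symm x y).antisymm (bounds_subset_symm y x)]

theorem dist_zero_self (x : Cadlag a b) : skorokhodDist x x = 0 := by
  refine le_antisymm ?_ (le_csInf (insert_nonempty _ _) (bounds_nonneg x x))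
  refine csInf_le (bddBelow_bounds x x) (Or.inr ⟨le_rfl, OrderIso.refl _, ?_, ?_⟩) <;> simp

theorem dist_tri (x y z : Cadlag a b) :
    skorokhodDist x z ≤ skorokhodDist x y + skorokhodDist y z := by
  refine le_of_forall_pos_lt_add fun η hη => ?_
  obtain ⟨r, hr, hr'⟩ := exists_lt_of_csInf_lt (insert_nonempty _ _)
    (show sInf (insert 1 (skorokhodBounds x y)) < skorokhodDist x y + η / 2 by
      unfold skorokhodDist; linarith)
  obtain ⟨s, hs, hs'⟩ := exists_lt_of_csInf_lt (insert_nonempty _ _)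
    (show sInf (insert 1 (skorokhodBounds y z)) < skorokhodDist y z + η / 2 by
      unfold skorokhodDist; linarith)
  have hr0 := bounds_nonneg x y r hr
  have hs0 := bounds_nonneg y z s hs
  have h1 : skorokhodDist x z ≤ 1 := csInf_le (bddBelow_bounds x z) (Or.inl rfl)
  suffices skorokhodDist x z ≤ r + s by linarith
  rcases hr with rfl | ⟨-, l, hl1, hl2⟩
  · linarith
  rcases hs with rfl | ⟨-, m, hm1, hm2⟩
  · linarith
  refine csInf_le (bddBelow_bounds x z) (Or.inr ⟨by linarith, l.trans m, fun t => ?_, fun t => ?_⟩)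
  · have e1 := abs_le.1 (hl1 t)
    have e2 := abs_le.1 (hm1 (l t))
    simp only [OrderIso.trans_apply]
    exact abs_le.2 ⟨by linarith, by linarith⟩
  · have e1 := abs_le.1 (hl2 t)
    have e2 := abs_le.1 (hm2 (l t))
    simp only [OrderIso.trans_apply]
    exact abs_le.2 ⟨by linarith, by linarith⟩

theorem eq_of_dist_zero {x y : Cadlag a b} (h : skorokhodDist x y = 0) : x = y := by
  have key : ∀ η : ℝ, 0 < η → ∃ lam : Icc a b ≃o Icc a b,
      (∀ t, |(lam t : ℝ) - (t : ℝ)| < η) ∧ ∀ t, |x t - y (lam t)| < η := by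
    intro η hη
    obtain ⟨r, hr, hr'⟩ := exists_lt_of_csInf_lt (insert_nonempty _ _)
      (show sInf (insert 1 (skorokhodBounds x y)) < min η 1 by
        change skorokhodDist x y < _
        rw [h]; exact lt_min hη one_pos)
    rcases hr with rfl | ⟨-, l, hl1, hl2⟩
    · exact absurd (hr'.trans_le (min_le_right _ _)) (lt_irrefl _)
    · have hrη := hr'.trans_le (min_le_left _ _)
      exact ⟨l, fun t => (hl1 t).trans_lt hrη, fun t => (hl2 t).trans_lt hrη⟩
  ext t
  refine eq_of_forall_dist_le fun ε hε => ?_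
  rw [Real.dist_eq]
  have hx := Metric.continuousWithinAt_iff.1 (x.isCadlag t).1 (ε / 3) (by positivity)
  have hy := Metric.continuousWithinAt_iff.1 (y.isCadlag t).1 (ε / 3) (by positivity)
  obtain ⟨d1, hd1, hx⟩ := hx
  obtain ⟨d2, hd2, hy⟩ := hy
  rcases eq_or_lt_of_le t.2.2 with htb | htb
  · obtain ⟨lam, -, h2⟩ := key ε hε
    have hlt : lam t = t := by
      refine le_antisymm ?_ ?_
      · exact Subtype.coe_le_coe.1 ((lam t).2.2.trans htb.ge)
      · have : lam.symm t ≤ t := Subtype.coe_le_coe.1 ((lam.symm t).2.2.trans htb.ge)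
        simpa using lam.monotone this
    have := h2 t
    rw [hlt] at this
    exact this.le
  · set d := min (min d1 d2) (b - t) with hd
    have hdpos : 0 < d := lt_min (lt_min hd1 hd2) (by linarith)
    have hdd1 : d ≤ d1 := (min_le_left _ _).trans (min_le_left _ _)
    have hdd2 : d ≤ d2 := (min_le_left _ _).trans (min_le_right _ _)
    have hdb : d ≤ b - t := min_le_right _ _
    have hta := t.2.1
    obtain ⟨lam, h1, h2⟩ := key (min (ε / 3) (d / 2)) (lt_min (by positivity) (by positivity))
    let s : Icc a b := ⟨t + d / 2, by linarith, by linarith⟩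
    have hs : (s : ℝ) = t + d / 2 := rfl
    have e1 := abs_lt.1 ((h1 s).trans_le (min_le_right _ _))
    have e2 := abs_lt.1 ((h2 s).trans_le (min_le_left _ _))
    have hts : t ≤ s := Subtype.coe_le_coe.1 (by linarith)
    have htl : t ≤ lam s := Subtype.coe_le_coe.1 (by linarith)
    have f1 := hx (x := s) hts (by
      rw [Subtype.dist_eq, Real.dist_eq, abs_lt]; constructor <;> linarith)
    have f2 := hy (x := lam s) htl (by
      rw [Subtype.dist_eq, Real.dist_eq, abs_lt]; constructor <;> linarith)
    rw [Real.dist_eq, abs_lt] at f1 f2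
    exact abs_le.2 ⟨by linarith, by linarith⟩

/-- `𝒟_I` with a bounded metric generating the `J₁` topology. Boundedly finite measures and the
`w#` topology depend on the metric only through its topology and its bounded sets, so every
other bounded metric generating `J₁` leads to the same objects. -/
noncomputable instance : MetricSpace (Cadlag a b) where
  dist := skorokhodDist
  dist_self := dist_zero_self
  dist_comm := dist_symm
  dist_triangle := dist_tri
  eq_of_dist_eq_zero := eq_of_dist_zero

noncomputable instance : MeasurableSpace (Cadlag a b) := borel _

instance : BorelSpace (Cadlag a b) := ⟨rfl⟩

end Cadlag

/-- The space `𝒟_I^ℓ`, with the product topology `J₁^ℓ`, a product metric (which has the same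
topology and bounded sets as the sum of the coordinate distances) and the Borel `σ`-field. -/
def CadlagVec (a b : ℝ) (ℓ : ℕ) : Type := Fin ℓ → Cadlag a b

namespace CadlagVec

variable {a b : ℝ} {ℓ : ℕ}

noncomputable instance : MetricSpace (CadlagVec a b ℓ) :=
  inferInstanceAs (MetricSpace (Fin ℓ → Cadlag a b))

noncomputable instance : MeasurableSpace (CadlagVec a b ℓ) := borel _

instance : BorelSpace (CadlagVec a b ℓ) := ⟨rfl⟩

/-- `Disc(x) = ⋃ i, Disc(x_i)`. -/
def Disc (x : CadlagVec a b ℓ) : Set (Icc a b) := ⋃ i, (x i).Disc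

/-- `max_i sup_t |x_i(t)|`, with values in `[0, ∞]`. -/
noncomputable def supNorm (x : CadlagVec a b ℓ) : ℝ≥0∞ := ⨆ i, ⨆ t, ‖x i t‖ₑ

end CadlagVec

/-- The unit sphere `𝒮_{I,ℓ}`, as a metric subspace of `𝒟_I^ℓ`. -/
abbrev CadlagSphere (a b : ℝ) (ℓ : ℕ) : Type := {x : CadlagVec a b ℓ // x.supNorm = 1}

/-- The half line `(0, ∞]`, metrized by `|1/r - 1/r'|`. -/
def Radius : Type := {r : ℝ≥0∞ // 0 < r}

theorem Radius.inv_injective :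
    Function.Injective (fun r : Radius => (r.1⁻¹).toReal) := by
  intro r s h
  apply Subtype.ext
  have hr : r.1⁻¹ ≠ ∞ := ENNReal.inv_ne_top.2 r.2.ne'
  have hs : s.1⁻¹ ≠ ∞ := ENNReal.inv_ne_top.2 s.2.ne'
  exact inv_inj.1 ((ENNReal.toReal_eq_toReal_iff' hr hs).1 h)

noncomputable instance : MetricSpace Radius :=
  MetricSpace.induced (fun r : Radius => (r.1⁻¹).toReal) Radius.inv_injective inferInstance

/-- The space `(0, ∞] × 𝒮_{I,ℓ}` with a product metric and the Borel `σ`-field. A set is bounded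
if and only if it lies in `[η, ∞] × 𝒮_{I,ℓ}` for some `η > 0`. -/
def PolarSpace (a b : ℝ) (ℓ : ℕ) : Type := Radius × CadlagSphere a b ℓ

namespace PolarSpace

variable {a b : ℝ} {ℓ : ℕ}

noncomputable instance : MetricSpace (PolarSpace a b ℓ) :=
  inferInstanceAs (MetricSpace (Radius × CadlagSphere a b ℓ))

noncomputable instance : MeasurableSpace (PolarSpace a b ℓ) := borel _

instance : BorelSpace (PolarSpace a b ℓ) := ⟨rfl⟩

/-- The radial coordinate `y` of `(y, w)`. -/
def radius (p : PolarSpace a b ℓ) : ℝ≥0∞ := p.1.1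

/-- The angular coordinate `w` of `(y, w)`. -/
def angle (p : PolarSpace a b ℓ) : CadlagVec a b ℓ := p.2.1

end PolarSpace

/-- The set `ℳ(X)` of boundedly finite Borel measures on a metric space. -/
def BddFinMeasure (X : Type*) [MetricSpace X] [MeasurableSpace X] : Type _ :=
  {μ : Measure X // ∀ A, MeasurableSet A → Bornology.IsBounded A → μ A < ∞}

namespace BddFinMeasure

variable {X : Type*} [MetricSpace X] [MeasurableSpace X]

/-- The `w#` topology: the coarsest one for which `μ ↦ ∫ f dμ` is continuous for all bounded
continuous functions `f` with bounded support. -/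
noncomputable instance : TopologicalSpace (BddFinMeasure X) :=
  TopologicalSpace.induced
    (fun (μ : BddFinMeasure X)
      (f : {f : X →ᵇ ℝ // Bornology.IsBounded (Function.support f)}) => ∫ x, f.1 x ∂μ.1)
    inferInstance

noncomputable instance : MeasurableSpace (BddFinMeasure X) := borel _

instance : BorelSpace (BddFinMeasure X) := ⟨rfl⟩

end BddFinMeasure

/-- The set `𝒩(X)` of point measures: boundedly finite measures taking integer values on
bounded Borel sets. As a subset of `ℳ(X)` it carries the `w#` topology. -/
def pointMeasures (X : Type*) [MetricSpace X] [MeasurableSpace X] : Set (BddFinMeasure X) :=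
  {m | ∀ A, MeasurableSet A → Bornology.IsBounded A → ∃ k : ℕ, m.1 A = k}

/-- The set `𝒩*(X)`, where `disc x` is the set of discontinuity points of `x`: point measures
`m` with `m {x, y} < 2` whenever `x ≠ y` and `disc x ∩ disc y ≠ ∅`. It contains every simple
point measure whose atoms have pairwise disjoint sets of discontinuity points. -/
def noCommonDisc {X T : Type*} [MetricSpace X] [MeasurableSpace X] (disc : X → Set T) :
    Set (pointMeasures X) :=
  {m | ∀ x y : X, x ≠ y → (disc x ∩ disc y).Nonempty → m.1.1 {x, y} < 2}

/-- `M` is a point process on `X`: a random element of `ℳ(X)` which is a.s. a point measure. -/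
def IsPointProcess {Ω X : Type*} [MeasurableSpace Ω] [MetricSpace X] [MeasurableSpace X]
    (P : Measure Ω) (M : Ω → BddFinMeasure X) : Prop :=
  Measurable M ∧ ∀ᵐ ω ∂P, M ω ∈ pointMeasures X

/-- `M` is a Poisson point process on `X` with control (mean) measure `μ`. -/
def IsPoissonProcess {Ω X : Type*} [MeasurableSpace Ω] [MetricSpace X] [MeasurableSpace X]
    (P : Measure Ω) (M : Ω → BddFinMeasure X) (μ : BddFinMeasure X) : Prop :=
  IsPointProcess P M ∧
  (∀ A, MeasurableSet A → Bornology.IsBounded A → ∀ k : ℕ,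
    P {ω | (M ω).1 A = k} = poissonMeasure (μ.1 A).toNNReal {k}) ∧
  (∀ (n : ℕ) (A : Fin n → Set X), (∀ i, MeasurableSet (A i)) →
    (∀ i, Bornology.IsBounded (A i)) → Pairwise (fun i j => Disjoint (A i) (A j)) →
    iIndepFun (fun i ω => (M ω).1 (A i)) P)

/-- The summation map `φ(m) = ∫ w m(dw)` on `𝒟_I`, the integral being taken pointwise. -/
noncomputable def summation {a b : ℝ} (m : Measure (Cadlag a b)) : Cadlag a b :=
  Cadlag.ofFun fun t => ∫ w, w t ∂m

/-- The summation map `Φ(m) = ∫ w m(dw)` on `𝒟_I^ℓ`, the integral being taken pointwise. -/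
noncomputable def summationVec {a b : ℝ} {ℓ : ℕ} (m : Measure (CadlagVec a b ℓ)) :
    CadlagVec a b ℓ :=
  fun i => Cadlag.ofFun fun t => ∫ w, w i t ∂m

/-- The set `(ε, ∞) × 𝒮_{I,ℓ}`. -/
def truncSet (a b : ℝ) (ℓ : ℕ) (ε : ℝ) : Set (PolarSpace a b ℓ) :=
  {p | ENNReal.ofReal ε < p.radius ∧ p.radius < ∞}

/-- The truncated sum `∫_{(ε,∞)} ∫_{𝒮_{I,ℓ}} y w m(dy,dw)`, the integral being taken pointwise. -/
noncomputable def truncSum {a b : ℝ} {ℓ : ℕ} (ε : ℝ) (m : Measure (PolarSpace a b ℓ)) :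
    CadlagVec a b ℓ :=
  fun i => Cadlag.ofFun fun t => ∫ p in truncSet a b ℓ ε, p.radius.toReal * p.angle i t ∂m

/-! Everything reduces to finite sums. On a bounded open set `U`, a point measure is a finite sum of
Dirac masses (`exists_eq_sum_dirac`), so the integral of càdlàg functions over `U` is a finite sum
of càdlàg functions. Since the metric `δ` is bounded, `U` may be the whole space `𝒟_I` or `𝒟_I^ℓ`;
on the polar space it is `truncSet`.

When point measures converge in `w#`, the masses of a continuity set of the limit are integers that
converge, so they are eventually constant (`eventually_measure_eq`). Applied to `U` and to small
neighbourhoods of the atoms, this matches the atoms with those of the limit, multiplicities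
included, and the matched atoms converge (`eventually_exists_eq_sum_dirac`). What remains is the
`J₁`-continuity of addition at functions without common jumps (`Cadlag.continuousAt_add`). To prove
it, time changes `lam` for `x` and `mu` for `y` are replaced by a single one, glued over short
intervals: it follows `lam` at the division points where `x` jumps and `mu` at the others.
Membership in `𝒩*` makes the discontinuity sets of the atoms pairwise disjoint; for a repeated atom
`x` this uses the pair `{x, 2x}`.

For the Poisson limit, `E[M ⊗ M]` is `μ ⊗ μ` plus the image of `μ` on the diagonal. Discontinuity
sets are countable and no fixed time carries mass, so by Fubini the relation "common discontinuity"
is `μ ⊗ μ`-null, and almost surely no two atoms in `U` are so related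
(`IsPoissonProcess.ae_pairwise_notMem`). A continuous mapping argument then applies. It is run
through countably many test integrals, which map `ℳ(𝒴)` continuously into a metrizable space and
still control the matching of atoms. -/

/-! ### Interval induction and gluing of time changes. -/

/-- Induction along a compact interval: a property which passes from `p` to `q` whenever
`good p q` holds propagates from the left end point to the right one, if every point is good with
respect to all close enough points on either side of it. -/
theorem Icc_induction {a b : ℝ} (hab : a ≤ b) {good : Icc a b → Icc a b → Prop}
    {H : Icc a b → Prop} (h0 : H ⟨a, left_mem_Icc.2 hab⟩)
    (hstep : ∀ p q, p < q → good p q → H p → H q)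
    (hl : ∀ c, ∀ᶠ p in 𝓝[<] c, good p c) (hr : ∀ c, ∀ᶠ q in 𝓝[>] c, good c q) :
    H ⟨b, right_mem_Icc.2 hab⟩ := by
  -- Let `c` be the largest limit of points satisfying `H`. Goodness to the left of `c` gives `H c`,
  -- and goodness to its right would carry `H` beyond `c` unless `c = b`.
  obtain ⟨c, hc, hmax⟩ := (isClosed_closure (s := {t | H t})).isCompact.exists_isGreatest
    ⟨_, subset_closure h0⟩
  have hHc : H c := by
    by_contra hn
    have hsub : {t | H t} ⊆ Iio c := fun t ht =>
      lt_of_le_of_ne (hmax (subset_closure ht)) (by rintro rfl; exact hn ht)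
    have hfr : ∃ᶠ p in 𝓝[<] c, H p := by
      rw [frequently_nhdsWithin_iff]
      refine (mem_closure_iff_frequently.1 hc).mono fun p hp => ⟨hp, hsub hp⟩
    obtain ⟨p, ⟨hp, hg⟩, hpc⟩ :=
      ((hfr.and_eventually (hl c)).and_eventually self_mem_nhdsWithin).exists
    exact hn (hstep p c hpc hg hp)
  rcases eq_or_lt_of_le c.2.2 with h | h
  · rwa [show (⟨b, right_mem_Icc.2 hab⟩ : Icc a b) = c from Subtype.ext h.symm]
  · exfalso
    have hcb : c < ⟨b, right_mem_Icc.2 hab⟩ := h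
    have : (𝓝[>] c).NeBot := nhdsGT_neBot_of_exists_gt ⟨_, hcb⟩
    obtain ⟨q, hg, hq⟩ := ((hr c).and self_mem_nhdsWithin).exists
    exact absurd (hmax (subset_closure (hstep c q hq hg hHc))) (not_le.2 hq)

/-- A time change of `[a, b]` which is the identity up to `p` and takes `u` to `v`. -/
theorem exists_orderIso_Icc {a b : ℝ} {p u v : Icc a b} (hpu : p < u) (hpv : p < v)
    (hu : (u : ℝ) < b) (hv : (v : ℝ) < b) :
    ∃ h : Icc a b ≃o Icc a b, (∀ t ≤ p, h t = t) ∧ h u = v := by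
  have hpu' : (p : ℝ) < u := hpu
  have hpv' : (p : ℝ) < v := hpv
  have hap : a ≤ p := p.2.1
  have hab : a ≤ b := hap.trans p.2.2
  -- `Δ` is a tent: zero up to `p`, one at `u`, zero again at `b`. The slopes of `(v - u) * Δ`
  -- exceed `-1` exactly because `p < v < b`, which makes `F` strictly increasing.
  let Δ : ℝ → ℝ := fun t => max 0 (min ((t - p) / (u - p)) ((b - t) / (b - u)))
  let F : ℝ → ℝ := fun t => t + (v - u) * Δ t
  have hup : (0 : ℝ) < u - p := by linarith
  have hbu : (0 : ℝ) < b - u := by linarith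
  have hΔcont : Continuous Δ := by
    refine continuous_const.max (Continuous.min ?_ ?_) <;> fun_prop
  have hF : Continuous F := by fun_prop
  have hΔp : ∀ t : ℝ, t ≤ p → Δ t = 0 := fun t ht =>
    max_eq_left ((min_le_left _ _).trans (div_nonpos_of_nonpos_of_nonneg (by linarith) hup.le))
  have hΔb : Δ b = 0 := max_eq_left ((min_le_right _ _).trans (by simp))
  have hΔu : Δ u = 1 := by
    simp only [Δ]; rw [div_self hup.ne', div_self hbu.ne']; simp
  have hmono : StrictMono F := by
    intro s t hst
    have h1 : Δ t ≤ Δ s + (t - s) / (u - p) := by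
      have : (t - p) / (u - p) = (s - p) / (u - p) + (t - s) / (u - p) := by ring
      have h' : 0 ≤ (t - s) / (u - p) := by apply div_nonneg <;> linarith
      have h'' : (b - t) / (b - u) ≤ (b - s) / (b - u) := by gcongr
      refine max_le (by positivity) ?_
      rw [this]
      refine le_trans ?_ (add_le_add_left (le_max_right _ _) _)
      rcases min_cases ((s - p) / (u - p)) ((b - s) / (b - u)) with h | h
      · rw [h.1]; exact min_le_left _ _
      · rw [h.1]; exact (min_le_right _ _).trans (by linarith)
    have h2 : Δ s ≤ Δ t + (t - s) / (b - u) := by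
      have : (b - s) / (b - u) = (b - t) / (b - u) + (t - s) / (b - u) := by ring
      have h' : 0 ≤ (t - s) / (b - u) := by apply div_nonneg <;> linarith
      have h'' : (s - p) / (u - p) ≤ (t - p) / (u - p) := by gcongr
      refine max_le (by positivity) ?_
      rw [this]
      refine le_trans ?_ (add_le_add_left (le_max_right _ _) _)
      rcases min_cases ((t - p) / (u - p)) ((b - t) / (b - u)) with h | h
      · rw [h.1]; exact (min_le_left _ _).trans (by linarith)
      · rw [h.1]; exact min_le_right _ _
    simp only [F]
    have hd : 0 < t - s := by linarith
    rcases le_total (u : ℝ) v with huv | huv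
    · have h3 : (v - u : ℝ) * ((t - s) / (b - u)) < t - s := by
        rw [mul_div_assoc', div_lt_iff₀ hbu, mul_comm]
        exact mul_lt_mul_of_pos_left (by linarith) hd
      nlinarith [mul_le_mul_of_nonneg_left h2 (sub_nonneg.2 huv)]
    · have h3 : (u - v : ℝ) * ((t - s) / (u - p)) < t - s := by
        rw [mul_div_assoc', div_lt_iff₀ hup, mul_comm]
        exact mul_lt_mul_of_pos_left (by linarith) hd
      nlinarith [mul_le_mul_of_nonneg_left h1 (sub_nonneg.2 huv)]
  have hFa : F a = a := by simp [F, hΔp a hap]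
  have hFb : F b = b := by simp [F, hΔb]
  have hmaps : ∀ t : Icc a b, F t ∈ Icc a b := fun t =>
    ⟨hFa.symm.trans_le (hmono.monotone t.2.1), (hmono.monotone t.2.2).trans_eq hFb⟩
  let G : Icc a b → Icc a b := fun t => ⟨F t, hmaps t⟩
  have hG : StrictMono G := fun s t hst => hmono hst
  have hsurj : Function.Surjective G := by
    intro y
    have := intermediate_value_Icc hab hF.continuousOn
    rw [hFa, hFb] at this
    obtain ⟨t, ht, hty⟩ := this y.2
    exact ⟨⟨t, ht⟩, Subtype.ext hty⟩
  refine ⟨hG.orderIsoOfSurjective G hsurj, fun t ht => Subtype.ext ?_, Subtype.ext ?_⟩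
  · change F t = t
    simp [F, hΔp t ht]
  · change F u = v
    simp [F, hΔu]

/-- Some time change of `[a, b]` takes `p` to `p'`, and up to time `p` it is `ε`-close to the
identity and matches `x` with `y` up to `ε`. -/
def MatchUpTo {a b : ℝ} (ε : ℝ) (x y : Icc a b → ℝ) (p p' : Icc a b) : Prop :=
  ∃ f : Icc a b ≃o Icc a b, f p = p' ∧
    ∀ t < p, |(f t : ℝ) - t| ≤ ε ∧ |x t - y (f t)| ≤ ε

/-- `MatchUpTo` asks nothing at the time `p` itself, so nothing is to be checked here. In return,
the values at `b` must be compared separately at the end. -/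
theorem MatchUpTo.start {a b : ℝ} (hab : a ≤ b) (ε : ℝ) (x y : Icc a b → ℝ) :
    MatchUpTo ε x y ⟨a, left_mem_Icc.2 hab⟩ ⟨a, left_mem_Icc.2 hab⟩ :=
  ⟨OrderIso.refl _, rfl, fun t ht => absurd t.2.1 (not_le.2 ht)⟩

theorem OrderIso.coe_apply_eq_right_iff {a b : ℝ} (f : Icc a b ≃o Icc a b) (t : Icc a b) :
    (f t : ℝ) = b ↔ (t : ℝ) = b := by
  have key : ∀ (g : Icc a b ≃o Icc a b) (s : Icc a b), (s : ℝ) = b → (g s : ℝ) = b := by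
    intro g s hs
    refine le_antisymm (g s).2.2 ?_
    have h : g.symm ⟨b, s.2.1.trans s.2.2, le_rfl⟩ ≤ s := by
      exact Subtype.coe_le_coe.1 ((g.symm _).2.2.trans_eq hs.symm)
    exact (OrderIso.symm_apply_le g).1 h
  exact ⟨fun h => by simpa using key f.symm (f t) h, key f t⟩

/-- Follow `f` by a time change that fixes everything up to `p'` and moves `f q` to `q'`. The part
before `p` is untouched, and `[p, q)` is sent into `[p', q')`, where the bounds hold for any pair of
points. Since time changes fix `b`, the end points must reach `b` together, whence `hend`. -/
theorem MatchUpTo.step {a b ε : ℝ} {x y : Icc a b → ℝ} {p p' q q' : Icc a b}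
    (h : MatchUpTo ε x y p p') (hpq : p < q) (hpq' : p' < q') (hend : (q : ℝ) = b ↔ (q' : ℝ) = b)
    (h1 : (q : ℝ) - p' ≤ ε) (h2 : (q' : ℝ) - p ≤ ε)
    (hxy : ∀ t, p ≤ t → t < q → ∀ u, p' ≤ u → u < q' → |x t - y u| ≤ ε) :
    MatchUpTo ε x y q q' := by
  obtain ⟨f, hf, hft⟩ := h
  obtain ⟨g, hg, hgq⟩ : ∃ g : Icc a b ≃o Icc a b, (∀ t ≤ p', g t = t) ∧ g (f q) = q' := by
    have hlt : p' < f q := by rw [← hf]; exact f.strictMono hpq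
    by_cases hq : (q : ℝ) = b
    · refine ⟨OrderIso.refl _, fun t _ => rfl, Subtype.ext ?_⟩
      rw [hend.1 hq]
      exact (f.coe_apply_eq_right_iff q).2 hq
    · exact exists_orderIso_Icc hlt hpq'
        (lt_of_le_of_ne (f q).2.2 fun h => hq ((f.coe_apply_eq_right_iff q).1 h))
        (lt_of_le_of_ne q'.2.2 fun h => hq (hend.2 h))
  refine ⟨f.trans g, hgq, fun t ht => ?_⟩
  simp only [OrderIso.trans_apply]
  rcases lt_or_ge t p with htp | htp
  · rw [hg (f t) (by rw [← hf]; exact f.monotone htp.le)]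
    exact hft t htp
  · have e1 : p' ≤ g (f t) := by
      rw [← hg p' le_rfl, ← hf]; exact g.monotone (f.monotone htp)
    have e2 : g (f t) < q' := by
      rw [← hgq]; exact g.strictMono (f.strictMono ht)
    refine ⟨?_, hxy t htp ht _ e1 e2⟩
    have e1' : (p' : ℝ) ≤ g (f t) := e1
    have e2' : (g (f t) : ℝ) < q' := e2
    have e3 : (p : ℝ) ≤ t := htp
    have e4 : (t : ℝ) < q := ht
    rw [abs_le]; constructor <;> linarith

/-! ### The Skorokhod distance and the continuity of addition. -/

namespace Cadlag

variable {a b : ℝ}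

theorem dist_le_of_orderIso {x y : Cadlag a b} {ε : ℝ} (hε : 0 ≤ ε) (f : Icc a b ≃o Icc a b)
    (h1 : ∀ t, |(f t : ℝ) - t| ≤ ε) (h2 : ∀ t, |x t - y (f t)| ≤ ε) : dist x y ≤ ε :=
  csInf_le (bddBelow_bounds x y) (Or.inr ⟨hε, f, h1, h2⟩)

theorem exists_orderIso_of_dist_lt {x y : Cadlag a b} {ε : ℝ} (h : dist x y < ε) (hε : ε ≤ 1) :
    ∃ f : Icc a b ≃o Icc a b, (∀ t, |(f t : ℝ) - t| ≤ ε) ∧ ∀ t, |x t - y (f t)| ≤ ε := by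
  obtain ⟨r, hr, hr'⟩ := exists_lt_of_csInf_lt (insert_nonempty _ _)
    (show sInf (insert 1 (skorokhodBounds x y)) < ε from h)
  rcases hr with rfl | ⟨-, l, hl1, hl2⟩
  · linarith
  · exact ⟨l, fun t => (hl1 t).trans hr'.le, fun t => (hl2 t).trans hr'.le⟩

theorem dist_le_of_matchUpTo {x y : Cadlag a b} {ε : ℝ} (hab : a ≤ b) (hε : 0 ≤ ε)
    (h : MatchUpTo ε x y ⟨b, right_mem_Icc.2 hab⟩ ⟨b, right_mem_Icc.2 hab⟩)
    (hb : |x ⟨b, right_mem_Icc.2 hab⟩ - y ⟨b, right_mem_Icc.2 hab⟩| ≤ ε) : dist x y ≤ ε := by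
  obtain ⟨f, hf, hft⟩ := h
  have : ∀ t, |(f t : ℝ) - t| ≤ ε ∧ |x t - y (f t)| ≤ ε := by
    intro t
    rcases eq_or_lt_of_le (show t ≤ ⟨b, right_mem_Icc.2 hab⟩ from t.2.2) with rfl | ht
    · rw [hf]; simpa using ⟨hε, hb⟩
    · exact hft t ht
  exact dist_le_of_orderIso hε f (fun t => (this t).1) fun t => (this t).2

/-- Close to the left and to the right of a point, a càdlàg function has small oscillation. -/
theorem eventually_osc_left (x : Cadlag a b) {ε : ℝ} (hε : 0 < ε) (c : Icc a b) :
    ∀ᶠ p in 𝓝[<] c, ∀ s t, p ≤ s → s < c → p ≤ t → t < c → |x s - x t| ≤ ε := by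
  obtain ⟨l, hl⟩ := (x.isCadlag c).2
  have h := hl (Metric.ball_mem_nhds l (half_pos hε))
  rw [mem_map] at h
  by_cases hbot : ∃ p, p < c
  · obtain ⟨p, hp⟩ := hbot
    obtain ⟨l', hl', hsub⟩ := (mem_nhdsLT_iff_exists_Ioo_subset' hp).1 h
    filter_upwards [Ioo_mem_nhdsLT hl'] with p hp s t hs hsc ht htc
    have e1 := hsub (show s ∈ Ioo l' c from ⟨hp.1.trans_le hs, hsc⟩)
    have e2 := hsub (show t ∈ Ioo l' c from ⟨hp.1.trans_le ht, htc⟩)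
    simp only [mem_preimage, Metric.mem_ball, Real.dist_eq, abs_lt] at e1 e2
    rw [abs_le]; constructor <;> linarith
  · have : Iio c = ∅ := by
      ext p; simp only [mem_Iio, mem_empty_iff_false, iff_false]; exact fun h => hbot ⟨p, h⟩
    rw [this]; simp

theorem eventually_osc_right (x : Cadlag a b) {ε : ℝ} (hε : 0 < ε) (c : Icc a b) :
    ∀ᶠ q in 𝓝[>] c, ∀ s t, c ≤ s → s < q → c ≤ t → t < q → |x s - x t| ≤ ε := by
  have h := (x.isCadlag c).1 (Metric.ball_mem_nhds (x c) (half_pos hε))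
  rw [mem_map] at h
  by_cases htop : ∃ p, c < p
  · obtain ⟨p, hp⟩ := htop
    obtain ⟨u, hu, hsub⟩ := (mem_nhdsGE_iff_exists_Ico_subset' hp).1 h
    filter_upwards [Ioo_mem_nhdsGT hu] with q hq s t hs hsq ht htq
    have e1 := hsub (show s ∈ Ico c u from ⟨hs, hsq.trans hq.2⟩)
    have e2 := hsub (show t ∈ Ico c u from ⟨ht, htq.trans hq.2⟩)
    simp only [mem_preimage, Metric.mem_ball, Real.dist_eq, abs_lt] at e1 e2
    rw [abs_le]; constructor <;> linarith
  · have : Ioi c = ∅ := by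
      ext p; simp only [mem_Ioi, mem_empty_iff_false, iff_false]; exact fun h => htop ⟨p, h⟩
    rw [this]; simp

theorem eventually_sub_le_left {ε : ℝ} (hε : 0 < ε) (c : Icc a b) :
    ∀ᶠ p : Icc a b in 𝓝[<] c, (c : ℝ) - p ≤ ε := by
  refine nhdsWithin_le_nhds ?_
  filter_upwards [Metric.ball_mem_nhds c hε] with p hp
  rw [Metric.mem_ball, Subtype.dist_eq, Real.dist_eq, abs_lt] at hp
  linarith

theorem eventually_sub_le_right {ε : ℝ} (hε : 0 < ε) (c : Icc a b) :
    ∀ᶠ q : Icc a b in 𝓝[>] c, (q : ℝ) - c ≤ ε := by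
  refine nhdsWithin_le_nhds ?_
  filter_upwards [Metric.ball_mem_nhds c hε] with p hp
  rw [Metric.mem_ball, Subtype.dist_eq, Real.dist_eq, abs_lt] at hp
  linarith

theorem isCadlag_add {f g : Icc a b → ℝ} (hf : IsCadlag f) (hg : IsCadlag g) :
    IsCadlag (fun t => f t + g t) := fun t => by
  obtain ⟨l, hl⟩ := (hf t).2
  obtain ⟨l', hl'⟩ := (hg t).2
  exact ⟨(hf t).1.add (hg t).1, l + l', hl.add hl'⟩

theorem isCadlag_const_mul {f : Icc a b → ℝ} (r : ℝ) (hf : IsCadlag f) :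
    IsCadlag (fun t => r * f t) := fun t => by
  obtain ⟨l, hl⟩ := (hf t).2
  exact ⟨continuousWithinAt_const.mul (hf t).1, r * l, tendsto_const_nhds.mul hl⟩

instance : Add (Cadlag a b) := ⟨fun x y => ⟨_, isCadlag_add x.isCadlag y.isCadlag⟩⟩

instance : SMul ℝ (Cadlag a b) := ⟨fun r x => ⟨_, isCadlag_const_mul r x.isCadlag⟩⟩

@[simp] theorem add_apply (x y : Cadlag a b) (t : Icc a b) : (x + y) t = x t + y t := rfl

@[simp] theorem smul_apply (r : ℝ) (x : Cadlag a b) (t : Icc a b) : (r • x) t = r * x t := rfl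

@[simp] theorem zero_apply (t : Icc a b) : (0 : Cadlag a b) t = 0 := rfl

theorem ext_fun {x y : Cadlag a b} (h : ∀ t, x t = y t) : x = y := Cadlag.ext (funext h)

instance : AddCommMonoid (Cadlag a b) where
  add_assoc x y z := ext_fun fun t => add_assoc (x t) (y t) (z t)
  zero_add x := ext_fun fun t => zero_add (x t)
  add_zero x := ext_fun fun t => add_zero (x t)
  add_comm x y := ext_fun fun t => add_comm (x t) (y t)
  nsmul := nsmulRec

theorem sum_apply {ι : Type*} (s : Finset ι) (x : ι → Cadlag a b) (t : Icc a b) :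
    (∑ i ∈ s, x i) t = ∑ i ∈ s, x i t := by
  classical
  induction s using Finset.induction_on with
  | empty => simp
  | insert i s hi ih => rw [Finset.sum_insert hi, Finset.sum_insert hi, add_apply, ih]

theorem disc_add_subset (x y : Cadlag a b) : (x + y).Disc ⊆ x.Disc ∪ y.Disc := by
  intro t ht
  by_contra h
  simp only [Disc, mem_union, mem_ofPred_eq, not_or, not_not] at h ht
  exact ht (h.1.add h.2)

theorem disc_smul_subset (r : ℝ) (x : Cadlag a b) : (r • x).Disc ⊆ x.Disc := by
  intro t ht
  by_contra h
  simp only [Disc, mem_ofPred_eq, not_not] at h ht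
  exact ht (continuousAt_const.mul h)

theorem disc_zero : (0 : Cadlag a b).Disc = ∅ := by
  ext t
  simp only [Disc, mem_ofPred_eq, mem_empty_iff_false, iff_false, not_not]
  exact continuousAt_const

theorem disc_sum_subset {ι : Type*} (s : Finset ι) (x : ι → Cadlag a b) :
    (∑ i ∈ s, x i).Disc ⊆ ⋃ i ∈ s, (x i).Disc := by
  classical
  induction s using Finset.induction_on with
  | empty => simp [disc_zero]
  | insert i s hi ih =>
    rw [Finset.sum_insert hi, Finset.set_biUnion_insert]
    exact (disc_add_subset _ _).trans (union_subset_union_right _ ih)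

/-- If `x'` is the composition of `x` with a time change `lam`, up to `ε`, and the interval
`[p', q')` is the image of `[p, q)` except for errors at the end points where `x` is continuous,
then `x` on `[p, q)` is close to `x'` on `[p', q')`. -/
theorem abs_sub_le_of_time_change {x x' : Icc a b → ℝ} {ε η : ℝ} {p q p' q' : Icc a b}
    (hpq : p < q) (hη : 0 < η)
    (hosc : ∀ s t, p ≤ s → s < q → p ≤ t → t < q → |x s - x t| ≤ ε)
    (lam : Icc a b ≃o Icc a b) (hlam : ∀ t, |(lam t : ℝ) - t| ≤ η)
    (hx : ∀ t, |x t - x' (lam t)| ≤ ε)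
    (hp : p' = lam p ∨ |(p' : ℝ) - p| ≤ η ∧ ∀ s : Icc a b, |(s : ℝ) - p| ≤ 2 * η → |x s - x p| ≤ ε)
    (hq : q' = lam q ∨ |(q' : ℝ) - q| ≤ η ∧ ∀ s : Icc a b, |(s : ℝ) - q| ≤ 2 * η → |x s - x q| ≤ ε)
    {t v : Icc a b} (hpt : p ≤ t) (htq : t < q) (hpv : p' ≤ v) (hvq : v < q') :
    |x t - x' v| ≤ 4 * ε := by
  have hε : 0 ≤ ε := (abs_nonneg _).trans (hx p)
  -- The preimage `u` of `v` can leave `[p, q)` only past an end point of the second kind. It is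
  -- then within `2 * η` of that end point, where `x` is nearly constant.
  obtain ⟨u, rfl⟩ := lam.surjective v
  have hu := hx u
  suffices |x t - x u| ≤ 3 * ε by
    have := abs_sub_le (x t) (x u) (x' (lam u)); linarith
  have hlu := abs_le.1 (hlam u)
  rcases lt_or_ge u p with h1 | h1
  · have hlt : lam u < lam p := lam.strictMono h1
    rcases hp with rfl | ⟨hp, hcp⟩
    · exact absurd hpv (not_le.2 hlt)
    have e1 : (p' : ℝ) ≤ lam u := hpv
    have e2 : (u : ℝ) < p := h1
    have e3 := abs_le.1 hp
    have e4 := hcp u (abs_le.2 ⟨by linarith, by linarith⟩)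
    have e5 := hosc t p hpt htq le_rfl hpq
    have := abs_sub_le (x t) (x p) (x u)
    rw [abs_sub_comm (x p)] at this
    linarith
  rcases lt_or_ge u q with h2 | h2
  · have := hosc t u hpt htq h1 h2
    linarith
  · have hlt : lam q ≤ lam u := lam.monotone h2
    rcases hq with rfl | ⟨hq, hcq⟩
    · exact absurd hvq (not_lt.2 hlt)
    have e1 : (lam u : ℝ) < q' := hvq
    have e2 : (q : ℝ) ≤ u := h2
    have e3 := abs_le.1 hq
    have e4 := hcq u (abs_le.2 ⟨by linarith, by linarith⟩)
    have hpq' : (p : ℝ) < q := hpq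
    -- The oscillation bound does not reach `q` itself, so the comparison passes through a point
    -- just before `q` that lies in its continuity neighbourhood.
    obtain ⟨w, hw1, hw2⟩ := exists_between (max_lt hpq' (show (q : ℝ) - 2 * η < q by linarith))
    obtain ⟨hw3, hw4⟩ := max_lt_iff.1 hw1
    let w' : Icc a b := ⟨w, p.2.1.trans hw3.le, hw2.le.trans q.2.2⟩
    have e5 := hcq w' (abs_le.2 ⟨by simp only [w']; linarith, by simp only [w']; linarith⟩)
    have e6 := hosc t w' hpt htq hw3.le hw2
    have := abs_sub_le (x t) (x w') (x u)
    have := abs_sub_le (x w') (x q) (x u)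
    rw [abs_sub_comm (x q)] at this
    linarith

theorem exists_continuity_radius {x : Icc a b → ℝ} {p : Icc a b} (h : ContinuousAt x p) {ε : ℝ}
    (hε : 0 < ε) : ∃ η > 0, ∀ s : Icc a b, |(s : ℝ) - p| ≤ 2 * η → |x s - x p| ≤ ε := by
  obtain ⟨d, hd, h⟩ := Metric.continuousAt_iff.1 h ε hε
  refine ⟨d / 4, by positivity, fun s hs => ?_⟩
  have := h (x := s) (by rw [Subtype.dist_eq, Real.dist_eq]; linarith)
  rw [Real.dist_eq] at this
  exact this.le

open Classical in
/-- Addition is `J₁`-continuous at pairs of functions without common discontinuities. -/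
theorem continuousAt_add {x y : Cadlag a b} (h : Disjoint x.Disc y.Disc) :
    ContinuousAt (fun z : Cadlag a b × Cadlag a b => z.1 + z.2) (x, y) := by
  rcases lt_or_ge b a with hba | hab
  · have : ∀ z : Cadlag a b, z = 0 := fun z => ext_fun fun t =>
      absurd (t.2.1.trans t.2.2) (not_le.2 hba)
    rw [show (fun z : Cadlag a b × Cadlag a b => z.1 + z.2) = fun _ => 0 from
      funext fun z => this _]
    exact continuousAt_const
  rw [Metric.continuousAt_iff]
  intro ε' hε'
  obtain ⟨ε, hε, hεε'⟩ : ∃ ε > 0, 8 * ε < ε' := ⟨ε' / 9, by positivity, by linarith⟩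
  -- Where `x` jumps, the division point must follow `lam` exactly, and `y` is continuous there by
  -- disjointness. Elsewhere `x` is continuous and the point may follow `mu`.
  let nu (lam mu : Icc a b ≃o Icc a b) (p : Icc a b) : Icc a b :=
    if p ∈ x.Disc then lam p else mu p
  -- The tolerance `η` may depend on `p` but serves all perturbations at once, so the induction
  -- takes the place of a choice of finite partition. The factor `8` is `4` for `x` plus `4` for
  -- `y`.
  let H : Icc a b → Prop := fun p => ∃ η > 0, ∀ (x' y' : Icc a b → ℝ)
    (lam mu : Icc a b ≃o Icc a b), (∀ t, |(lam t : ℝ) - t| ≤ η) → (∀ t, |(mu t : ℝ) - t| ≤ η) →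
    (∀ t, |x t - x' (lam t)| ≤ η) → (∀ t, |y t - y' (mu t)| ≤ η) →
    MatchUpTo (8 * ε) (x + y) (fun t => x' t + y' t) p (nu lam mu p)
  have hcont : ∀ p, ∃ η > 0,
      (p ∉ x.Disc → ∀ s : Icc a b, |(s : ℝ) - p| ≤ 2 * η → |x s - x p| ≤ ε) ∧
      (p ∈ x.Disc → ∀ s : Icc a b, |(s : ℝ) - p| ≤ 2 * η → |y s - y p| ≤ ε) := by
    intro p
    by_cases hp : p ∈ x.Disc
    · have hc : ContinuousAt y p := not_not.1 (disjoint_left.1 h hp)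
      obtain ⟨η, h0, h1⟩ := exists_continuity_radius hc hε
      exact ⟨η, h0, fun h => absurd hp h, fun _ => h1⟩
    · obtain ⟨η, h0, h1⟩ := exists_continuity_radius (not_not.1 hp) hε
      exact ⟨η, h0, fun _ => h1, fun h => absurd h hp⟩
  have hH : H ⟨b, right_mem_Icc.2 hab⟩ := by
    refine Icc_induction (good := fun p q =>
      ((q : ℝ) - p ≤ ε) ∧
      (∀ s t, p ≤ s → s < q → p ≤ t → t < q → |x s - x t| ≤ ε) ∧
      (∀ s t, p ≤ s → s < q → p ≤ t → t < q → |y s - y t| ≤ ε)) hab ?_ ?_ ?_ ?_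
    · refine ⟨1, one_pos, fun x' y' lam mu _ _ _ _ => ?_⟩
      have hbot : ∀ f : Icc a b ≃o Icc a b,
          f ⟨a, left_mem_Icc.2 hab⟩ = ⟨a, left_mem_Icc.2 hab⟩ := fun f => by
        refine le_antisymm ?_ (f _).2.1
        have : (⟨a, left_mem_Icc.2 hab⟩ : Icc a b) ≤ f.symm ⟨a, left_mem_Icc.2 hab⟩ :=
          (f.symm _).2.1
        simpa using f.monotone this
      have : nu lam mu ⟨a, left_mem_Icc.2 hab⟩ = ⟨a, left_mem_Icc.2 hab⟩ := by
        simp only [nu]; split_ifs <;> exact hbot _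
      rw [this]
      exact MatchUpTo.start hab _ _ _
    · rintro p q hpq ⟨hg0, hgx, hgy⟩ ⟨η₁, hη₁, hp⟩
      obtain ⟨η₂, hη₂, hpx, hpy⟩ := hcont p
      obtain ⟨η₃, hη₃, hqx, hqy⟩ := hcont q
      have hpq' : (p : ℝ) < q := hpq
      -- Each division point moves by at most `η`, so `η ≤ (q - p) / 3` keeps the images of `p` and
      -- `q` in order.
      obtain ⟨η, hη, hle⟩ : ∃ η > 0, η ≤ η₁ ∧ η ≤ η₂ ∧ η ≤ η₃ ∧ η ≤ ε ∧
          η ≤ ((q : ℝ) - p) / 3 := by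
        refine ⟨min η₁ (min η₂ (min η₃ (min ε (((q : ℝ) - p) / 3)))), ?_, ?_⟩
        · have : (0 : ℝ) < ((q : ℝ) - p) / 3 := by linarith
          positivity
        · simp
      obtain ⟨hle1, hle2, hle3, hle4, hle5⟩ := hle
      refine ⟨η, hη, fun x' y' lam mu h1 h2 h3 h4 => ?_⟩
      have hnu : ∀ t, |(nu lam mu t : ℝ) - t| ≤ η := fun t => by
        simp only [nu]; split_ifs
        · exact h1 t
        · exact h2 t
      have hnup := abs_le.1 (hnu p)
      have hnuq := abs_le.1 (hnu q)
      refine (hp x' y' lam mu (fun t => (h1 t).trans hle1) (fun t => (h2 t).trans hle1)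
        (fun t => (h3 t).trans hle1) (fun t => (h4 t).trans hle1)).step hpq
        (show (nu lam mu p : ℝ) < nu lam mu q by linarith) ?_ (by linarith) (by linarith) ?_
      · simp only [nu]; split_ifs
        · exact (lam.coe_apply_eq_right_iff q).symm
        · exact (mu.coe_apply_eq_right_iff q).symm
      · intro t hpt htq v hpv hvq
        have hX : |x t - x' v| ≤ 4 * ε := by
          refine abs_sub_le_of_time_change hpq hη hgx lam h1 (fun t => (h3 t).trans hle4) ?_ ?_
            hpt htq hpv hvq
          · by_cases hd : p ∈ x.Disc
            · exact Or.inl (by simp [nu, hd])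
            · exact Or.inr ⟨hnu p, fun s hs => hpx hd s (by linarith)⟩
          · by_cases hd : q ∈ x.Disc
            · exact Or.inl (by simp [nu, hd])
            · exact Or.inr ⟨hnu q, fun s hs => hqx hd s (by linarith)⟩
        have hY : |y t - y' v| ≤ 4 * ε := by
          refine abs_sub_le_of_time_change hpq hη hgy mu h2 (fun t => (h4 t).trans hle4) ?_ ?_
            hpt htq hpv hvq
          · by_cases hd : p ∈ x.Disc
            · exact Or.inr ⟨hnu p, fun s hs => hpy hd s (by linarith)⟩
            · exact Or.inl (by simp [nu, hd])
          · by_cases hd : q ∈ x.Disc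
            · exact Or.inr ⟨hnu q, fun s hs => hqy hd s (by linarith)⟩
            · exact Or.inl (by simp [nu, hd])
        rw [abs_le] at hX hY ⊢
        simp only [add_apply]
        constructor <;> linarith
    · intro c
      filter_upwards [eventually_sub_le_left hε c, x.eventually_osc_left hε c,
        y.eventually_osc_left hε c] with p h1 h2 h3
      exact ⟨h1, h2, h3⟩
    · intro c
      filter_upwards [eventually_sub_le_right hε c, x.eventually_osc_right hε c,
        y.eventually_osc_right hε c] with p h1 h2 h3
      exact ⟨h1, h2, h3⟩
  obtain ⟨η, hη, hb⟩ := hH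
  set top : Icc a b := ⟨b, right_mem_Icc.2 hab⟩ with htop
  have hfix : ∀ f : Icc a b ≃o Icc a b, f top = top := fun f =>
    Subtype.ext ((f.coe_apply_eq_right_iff top).2 rfl)
  refine ⟨min (min η ε) 1, by positivity, fun {z} hz => ?_⟩
  obtain ⟨hz1, hz2⟩ := max_lt_iff.1 (show max (dist z.1 x) (dist z.2 y) < _ from hz)
  rw [dist_comm] at hz1 hz2
  obtain ⟨lam, hl1, hl2⟩ := exists_orderIso_of_dist_lt hz1 (min_le_right _ _)
  obtain ⟨mu, hm1, hm2⟩ := exists_orderIso_of_dist_lt hz2 (min_le_right _ _)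
  have hle1 : min (min η ε) 1 ≤ η := (min_le_left _ _).trans (min_le_left _ _)
  have hle2 : min (min η ε) 1 ≤ ε := (min_le_left _ _).trans (min_le_right _ _)
  have hm := hb z.1 z.2 lam mu (fun t => (hl1 t).trans hle1) (fun t => (hm1 t).trans hle1)
    (fun t => (hl2 t).trans hle1) (fun t => (hm2 t).trans hle1)
  have hnu : nu lam mu top = top := by
    simp only [nu]; split_ifs <;> exact hfix _
  rw [hnu] at hm
  rw [dist_comm]
  refine lt_of_le_of_lt (dist_le_of_matchUpTo hab (by positivity) hm ?_) hεε'
  have e1 := hl2 top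
  have e2 := hm2 top
  rw [hfix, abs_le] at e1 e2
  rw [← htop, abs_le]
  simp only [add_apply]
  constructor <;> linarith

/-- A finite sum is `J₁`-continuous at families without common discontinuities. -/
theorem tendsto_sum {ι α : Type*} {l : Filter α} (s : Finset ι) {x : ι → Cadlag a b}
    (h : Pairwise fun i j => Disjoint (x i).Disc (x j).Disc) {x' : α → ι → Cadlag a b}
    (hx : ∀ i ∈ s, Tendsto (fun n => x' n i) l (𝓝 (x i))) :
    Tendsto (fun n => ∑ i ∈ s, x' n i) l (𝓝 (∑ i ∈ s, x i)) := by
  classical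
  induction s using Finset.induction_on with
  | empty => simpa using tendsto_const_nhds
  | insert i s hi ih =>
    simp only [Finset.sum_insert hi]
    have hd : Disjoint (x i).Disc (∑ j ∈ s, x j).Disc := by
      refine Disjoint.mono_right (disc_sum_subset s x) ?_
      simp only [disjoint_iUnion_right]
      exact fun j hj => h (by rintro rfl; exact hi hj)
    have := (continuousAt_add hd).tendsto.comp ((hx i (by simp)).prodMk_nhds
      (ih fun j hj => hx j (by simp [hj])))
    exact this

end Cadlag

/-! ### Discretization on grids: separability of `𝒟_I` and measurability of evaluations. -/

namespace Cadlag

variable {a b : ℝ}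

/-- The largest point not exceeding `t` of the grid of mesh `1 / (n + 1)` in `[a, b]`, where the
end points belong to the grid. -/
noncomputable def gridFloor (n : ℕ) (t : Icc a b) : Icc a b :=
  if (t : ℝ) = b then t else
    ⟨max a (⌊((n : ℝ) + 1) * t⌋ / ((n : ℝ) + 1)), le_max_left _ _,
      max_le (t.2.1.trans t.2.2) (((div_le_iff₀' (by positivity)).2 (Int.floor_le _)).trans t.2.2)⟩

theorem gridFloor_of_ne {n : ℕ} {t : Icc a b} (h : (t : ℝ) ≠ b) :
    (gridFloor n t : ℝ) = max a (⌊((n : ℝ) + 1) * t⌋ / ((n : ℝ) + 1)) := by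
  rw [gridFloor, if_neg h]

theorem gridFloor_of_eq {n : ℕ} {t : Icc a b} (h : (t : ℝ) = b) : gridFloor n t = t := by
  rw [gridFloor, if_pos h]

theorem gridFloor_le (n : ℕ) (t : Icc a b) : gridFloor n t ≤ t := by
  by_cases h : (t : ℝ) = b
  · rw [gridFloor_of_eq h]
  · rw [← Subtype.coe_le_coe, gridFloor_of_ne h]
    exact max_le t.2.1 ((div_le_iff₀' (by positivity)).2 (Int.floor_le _))

theorem sub_le_gridFloor (n : ℕ) (t : Icc a b) : (t : ℝ) - 1 / ((n : ℝ) + 1) ≤ gridFloor n t := by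
  have hn : (0 : ℝ) < (n : ℝ) + 1 := by positivity
  by_cases h : (t : ℝ) = b
  · rw [gridFloor_of_eq h]
    have : 0 < 1 / ((n : ℝ) + 1) := by positivity
    linarith
  · rw [gridFloor_of_ne h]
    refine le_max_of_le_right ?_
    rw [le_div_iff₀' hn, mul_sub, mul_one_div_cancel hn.ne']
    exact (Int.sub_one_lt_floor _).le

theorem finite_range_gridFloor (n : ℕ) : (range (gridFloor (a := a) (b := b) n)).Finite := by
  have hn : (0 : ℝ) < (n : ℝ) + 1 := by positivity
  have hfin : (insert b ((fun k : ℤ => max a (k / ((n : ℝ) + 1))) ''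
      Icc ⌊((n : ℝ) + 1) * a⌋ ⌊((n : ℝ) + 1) * b⌋)).Finite :=
    ((finite_Icc _ _).image _).insert b
  refine (hfin.preimage (f := ((↑) : Icc a b → ℝ)) Subtype.val_injective.injOn).subset ?_
  rintro _ ⟨t, rfl⟩
  by_cases h : (t : ℝ) = b
  · rw [gridFloor_of_eq h]; exact Or.inl h
  · refine Or.inr ⟨⌊((n : ℝ) + 1) * t⌋, ⟨?_, ?_⟩, (gridFloor_of_ne h).symm⟩
    · exact Int.floor_mono (mul_le_mul_of_nonneg_left t.2.1 hn.le)
    · exact Int.floor_mono (mul_le_mul_of_nonneg_left t.2.2 hn.le)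

/-- Just to the right of `t` the floor of `(n + 1) * s` keeps its value at `t`, and just to the left
it is the ceiling minus one. Thus `gridFloor n` is constant near `t` on either side, and `v` may be
arbitrary. -/
theorem isCadlag_comp_gridFloor (n : ℕ) (v : Icc a b → ℝ) :
    IsCadlag (fun t => v (gridFloor n t)) := by
  have hn : (0 : ℝ) < (n : ℝ) + 1 := by positivity
  intro t
  have hcont : Continuous fun s : Icc a b => ((n : ℝ) + 1) * s := by fun_prop
  constructor
  · have hev : ∀ᶠ s in 𝓝[≥] t, gridFloor n s = gridFloor n t := by
      by_cases h : (t : ℝ) = b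
      · filter_upwards [self_mem_nhdsWithin] with s hs
        rw [show s = t from le_antisymm (Subtype.coe_le_coe.1 (s.2.2.trans_eq h.symm)) hs]
      · have h1 : Tendsto (fun s : Icc a b => ((n : ℝ) + 1) * s) (𝓝[≥] t)
            (𝓝[≥] (((n : ℝ) + 1) * t)) :=
          tendsto_nhdsWithin_of_tendsto_nhds_of_eventually_within _
            (hcont.continuousAt.tendsto.mono_left nhdsWithin_le_nhds)
            (eventually_nhdsWithin_of_forall fun s hs =>
              mul_le_mul_of_nonneg_left (show (t : ℝ) ≤ s from hs) hn.le)
        have h2 := ((tendsto_floor_right_pure_floor _).comp h1).eventually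
          (eventually_pure.2 (show (fun m : ℤ => m = ⌊((n : ℝ) + 1) * t⌋) _ from rfl))
        have h3 : ∀ᶠ s : Icc a b in 𝓝[≥] t, (s : ℝ) ≠ b :=
          nhdsWithin_le_nhds (continuous_subtype_val.continuousAt.eventually_ne h)
        filter_upwards [h2, h3] with s hs hsb
        refine Subtype.ext ?_
        simp only [Function.comp_apply] at hs
        rw [gridFloor_of_ne hsb, gridFloor_of_ne h, hs]
    refine ContinuousWithinAt.congr_of_eventuallyEq continuousWithinAt_const
      (hev.mono fun s hs => ?_) rfl (f := fun _ => v (gridFloor n t))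
    simp only [hs]
  · have h1 : Tendsto (fun s : Icc a b => ((n : ℝ) + 1) * s) (𝓝[<] t)
        (𝓝[<] (((n : ℝ) + 1) * t)) :=
      tendsto_nhdsWithin_of_tendsto_nhds_of_eventually_within _
        (hcont.continuousAt.tendsto.mono_left nhdsWithin_le_nhds)
        (eventually_nhdsWithin_of_forall fun s hs =>
          mul_lt_mul_of_pos_left (show (s : ℝ) < t from hs) hn)
    have h2 := ((tendsto_floor_left_pure_ceil_sub_one _).comp h1).eventually
      (eventually_pure.2 (show (fun m : ℤ => m = ⌈((n : ℝ) + 1) * t⌉ - 1) _ from rfl))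
    rcases (𝓝[<] t).eq_or_neBot with hbot | hbot
    · exact ⟨0, by rw [hbot]; exact tendsto_bot⟩
    · obtain ⟨s₀, hs₀, hs₀t⟩ := (h2.and self_mem_nhdsWithin).exists
      refine ⟨v (gridFloor n s₀), tendsto_const_nhds.congr' ?_⟩
      filter_upwards [h2, self_mem_nhdsWithin] with s hs hst
      have hne : ∀ r : Icc a b, r < t → (r : ℝ) ≠ b := fun r hr =>
        (lt_of_lt_of_le (show (r : ℝ) < t from hr) t.2.2).ne
      congr 1
      refine Subtype.ext ?_
      simp only [Function.comp_apply] at hs hs₀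
      rw [gridFloor_of_ne (hne s hst), gridFloor_of_ne (hne s₀ hs₀t), ← hs, ← hs₀]

/-- The step function on the grid of mesh `1 / (n + 1)` with given values at the grid points. -/
noncomputable def stepFun (n : ℕ) (v : range (gridFloor (a := a) (b := b) n) → ℝ) : Cadlag a b :=
  ⟨fun t => v ⟨gridFloor n t, mem_range_self t⟩, by
    classical
    have := isCadlag_comp_gridFloor n
      (fun s => if h : s ∈ range (gridFloor (a := a) (b := b) n) then v ⟨s, h⟩ else 0)
    simpa only [mem_range_self, dif_pos] using this⟩

/-- With the identity as time change, the `J₁` distance is at most the sup distance of the values on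
the finite grid. -/
theorem continuous_stepFun (n : ℕ) : Continuous (stepFun (a := a) (b := b) n) := by
  have := (finite_range_gridFloor (a := a) (b := b) n).fintype
  refine LipschitzWith.continuous (K := 1) (LipschitzWith.mk_one fun v w => ?_)
  refine dist_le_of_orderIso dist_nonneg (OrderIso.refl _) (fun t => ?_) fun t => ?_
  · simp
  · exact dist_le_pi_dist v w ⟨gridFloor n t, mem_range_self t⟩

/-- The discretization of a càdlàg function on the grid of mesh `1 / (n + 1)`. -/
noncomputable def discretize (n : ℕ) (x : Cadlag a b) : Cadlag a b := stepFun n fun s => x s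

theorem discretize_apply (n : ℕ) (x : Cadlag a b) (t : Icc a b) :
    discretize n x t = x (gridFloor n t) := rfl

/-- The witness is `q` rounded up to the grid and capped at `b`: rounding up is adjoint to rounding
down. The condition `a < q` discards the value `a` in the definition of `gridFloor`. -/
theorem exists_gridCeil (n : ℕ) {q : Icc a b} (hq : a < q) :
    ∃ q' : Icc a b, ∀ u, q' ≤ u ↔ q ≤ gridFloor n u := by
  have hn : (0 : ℝ) < (n : ℝ) + 1 := by positivity
  have hle : (q : ℝ) ≤ ⌈((n : ℝ) + 1) * q⌉ / ((n : ℝ) + 1) :=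
    (le_div_iff₀' hn).2 (Int.le_ceil _)
  refine ⟨⟨min b (⌈((n : ℝ) + 1) * q⌉ / ((n : ℝ) + 1)),
    le_min (q.2.1.trans q.2.2) (q.2.1.trans hle), min_le_left _ _⟩, fun u => ?_⟩
  by_cases hu : (u : ℝ) = b
  · rw [gridFloor_of_eq hu]
    refine iff_of_true (Subtype.coe_le_coe.1 ?_) (Subtype.coe_le_coe.1 ?_)
    · rw [hu]; exact min_le_left _ _
    · rw [hu]; exact q.2.2
  · rw [← Subtype.coe_le_coe, ← Subtype.coe_le_coe, gridFloor_of_ne hu]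
    have hub : ¬ b ≤ u := fun h => hu (le_antisymm u.2.2 h)
    simp only [min_le_iff, hub, false_or, le_max_iff, not_le.2 hq]
    rw [div_le_iff₀' hn, le_div_iff₀' hn, ← Int.le_floor, ← Int.ceil_le]

/-- The discretized function repeats the jumps of `x` with a delay of at most one mesh. A division
point `p` is matched with the first time `p'` at which `gridFloor n` reaches `p`, so `[p', q')` is
the set of times read off in `[p, q)`. -/
theorem tendsto_discretize (x : Cadlag a b) :
    Tendsto (fun n => discretize n x) atTop (𝓝 x) := by
  rcases lt_or_ge b a with hba | hab
  · have : ∀ z : Cadlag a b, z = 0 := fun z => ext_fun fun t =>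
      absurd (t.2.1.trans t.2.2) (not_le.2 hba)
    rw [this x, show (fun n => discretize n (0 : Cadlag a b)) = fun _ => 0 from
      funext fun n => this _]
    exact tendsto_const_nhds
  have hsmall : ∀ ε : ℝ, 0 < ε → ∀ᶠ n : ℕ in atTop, 1 / ((n : ℝ) + 1) < ε := fun ε hε =>
    tendsto_one_div_add_atTop_nhds_zero_nat.eventually (gt_mem_nhds hε)
  rw [Metric.tendsto_atTop']
  suffices ∀ ε > 0, ∀ᶠ n in atTop, dist x (discretize n x) ≤ 2 * ε by
    intro ε hε
    obtain ⟨N, hN⟩ := eventually_atTop.1 (this (ε / 3) (by positivity))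
    refine ⟨N, fun n hn => ?_⟩
    rw [dist_comm]
    exact (hN n hn.le).trans_lt (by linarith)
  intro ε hε
  have key : ∀ᶠ n : ℕ in atTop, ∃ p' : Icc a b,
      (∀ u, p' ≤ u ↔ ⟨b, right_mem_Icc.2 hab⟩ ≤ gridFloor n u) ∧
      MatchUpTo (2 * ε) x (discretize n x) ⟨b, right_mem_Icc.2 hab⟩ p' := by
    refine Icc_induction (good := fun p q => ((q : ℝ) - p ≤ ε) ∧
      (∀ s t, p ≤ s → s < q → p ≤ t → t < q → |x s - x t| ≤ ε))
      (H := fun p => ∀ᶠ n : ℕ in atTop, ∃ p' : Icc a b, (∀ u, p' ≤ u ↔ p ≤ gridFloor n u) ∧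
        MatchUpTo (2 * ε) x (discretize n x) p p') hab ?_ ?_ ?_ ?_
    · exact Eventually.of_forall fun n => ⟨⟨a, left_mem_Icc.2 hab⟩,
        fun u => iff_of_true u.2.1 (gridFloor n u).2.1, MatchUpTo.start hab _ _ _⟩
    · rintro p q hpq ⟨hg0, hgx⟩ hp
      have hpq' : (p : ℝ) < q := hpq
      -- A mesh below `b - q` prevents the delayed point `q'` from reaching `b` before `q` does.
      have hqb : ∀ᶠ n : ℕ in atTop, (q : ℝ) ≠ b → 1 / ((n : ℝ) + 1) < b - q := by
        by_cases h : (q : ℝ) = b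
        · simp [h]
        · filter_upwards [hsmall (b - q) (sub_pos.2 (lt_of_le_of_ne q.2.2 h))] with n hn _
          exact hn
      filter_upwards [hp, hsmall ε hε, hsmall (q - p) (by linarith), hqb]
        with n ⟨p', hp', hm⟩ hn1 hn2 hn3
      have hupper : ∀ r r' : Icc a b, (∀ u, r' ≤ u ↔ r ≤ gridFloor n u) →
          (r' : ℝ) ≤ r + 1 / ((n : ℝ) + 1) := by
        intro r r' h
        by_contra! hlt
        have hpos : 0 < 1 / ((n : ℝ) + 1) := by positivity
        have h2 := r'.2.2
        let u : Icc a b := ⟨r + 1 / ((n : ℝ) + 1), by linarith [r.2.1], by linarith⟩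
        have hu : r ≤ gridFloor n u := by
          rw [← Subtype.coe_le_coe]
          have := sub_le_gridFloor n u
          simp only [u] at this ⊢
          linarith
        exact absurd ((h u).2 hu) (not_le.2 hlt)
      have hlower : ∀ r r' : Icc a b, (∀ u, r' ≤ u ↔ r ≤ gridFloor n u) → r ≤ r' :=
        fun r r' h => ((h r').1 le_rfl).trans (gridFloor_le n r')
      obtain ⟨q', hq'⟩ := exists_gridCeil n (p.2.1.trans_lt hpq')
      have e1 := hupper p p' hp'
      have e2 := hupper q q' hq'
      have e3 : (p : ℝ) ≤ p' := hlower p p' hp'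
      have e4 : (q : ℝ) ≤ q' := hlower q q' hq'
      refine ⟨q', hq', hm.step hpq ?_ ?_ ?_ ?_ ?_⟩
      · exact lt_of_lt_of_le (show (p' : ℝ) < q by linarith) e4
      · refine ⟨fun h => le_antisymm q'.2.2 (h.symm.trans_le e4), fun h => ?_⟩
        by_contra hne
        linarith [hn3 hne]
      · linarith
      · linarith
      · intro t hpt htq u hpu huq
        have h1 := (hp' u).1 hpu
        have h2 : gridFloor n u < q := lt_of_not_ge fun h => not_le.2 huq ((hq' u).2 h)
        rw [discretize_apply]
        linarith [hgx t (gridFloor n u) hpt htq h1 h2]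
    · intro c
      filter_upwards [eventually_sub_le_left hε c, x.eventually_osc_left hε c] with p h1 h2
      exact ⟨h1, h2⟩
    · intro c
      filter_upwards [eventually_sub_le_right hε c, x.eventually_osc_right hε c] with p h1 h2
      exact ⟨h1, h2⟩
  filter_upwards [key] with n ⟨p', hp', hm⟩
  have hpb : p' = ⟨b, right_mem_Icc.2 hab⟩ :=
    le_antisymm p'.2.2 (((hp' p').1 le_rfl).trans (gridFloor_le n p'))
  rw [hpb] at hm
  refine dist_le_of_matchUpTo hab (by positivity) hm ?_
  rw [discretize_apply, gridFloor_of_eq rfl, sub_self, abs_zero]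
  positivity

/-- The step functions on the `n`-th grid are a continuous image of a finite-dimensional space, and
the union over `n` is dense. -/
instance : TopologicalSpace.SeparableSpace (Cadlag a b) := by
  rw [← TopologicalSpace.isSeparable_univ_iff]
  have hsep : TopologicalSpace.IsSeparable (⋃ n, range (stepFun (a := a) (b := b) n)) := by
    refine TopologicalSpace.IsSeparable.iUnion fun n => ?_
    have := (finite_range_gridFloor (a := a) (b := b) n).fintype
    exact TopologicalSpace.isSeparable_range (continuous_stepFun n)
  refine hsep.closure.mono fun x _ => ?_
  exact mem_closure_of_tendsto (tendsto_discretize x)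
    (Eventually.of_forall fun n => mem_iUnion.2 ⟨n, mem_range_self _⟩)

instance : SecondCountableTopology (Cadlag a b) :=
  UniformSpace.secondCountable_of_separable _

/-- A map into `𝒟_I` is Borel measurable as soon as its evaluations are. -/
theorem measurable_of_eval {Ω : Type*} [MeasurableSpace Ω] {X : Ω → Cadlag a b}
    (h : ∀ t, Measurable fun ω => X ω t) : Measurable X := by
  -- Each discretization is a continuous function of finitely many evaluations.
  refine measurable_of_tendsto_metrizable (f := fun n ω => discretize n (X ω)) (fun n => ?_)
    (tendsto_pi_nhds.2 fun ω => tendsto_discretize (X ω))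
  have := (finite_range_gridFloor (a := a) (b := b) n).fintype
  exact (continuous_stepFun n).measurable.comp (measurable_pi_lambda _ fun s => h s)

theorem exists_orderIso_of_dist_lt' {x y : Cadlag a b} {ε : ℝ} (h : dist x y < min ε 1) :
    ∃ f : Icc a b ≃o Icc a b, (∀ t, |(f t : ℝ) - t| ≤ ε) ∧ ∀ t, |x t - y (f t)| ≤ ε := by
  obtain ⟨f, h1, h2⟩ := exists_orderIso_of_dist_lt h (min_le_right _ _)
  exact ⟨f, fun t => (h1 t).trans (min_le_left _ _), fun t => (h2 t).trans (min_le_left _ _)⟩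

/-- Evaluation at a point is Borel measurable. -/
theorem measurable_eval (t : Icc a b) : Measurable fun w : Cadlag a b => w t := by
  by_cases htb : (t : ℝ) = b
  -- Time changes fix `b`, so evaluation at `b` is even continuous.
  · refine Continuous.measurable (Metric.continuous_iff.2 fun w ε hε =>
      ⟨min (ε / 2) 1, by positivity, fun w' hw' => ?_⟩)
    obtain ⟨f, -, h2⟩ := exists_orderIso_of_dist_lt' hw'
    have := h2 t
    rw [show f t = t from Subtype.ext (((f.coe_apply_eq_right_iff t).2 htb).trans htb.symm)]
      at this
    rw [Real.dist_eq]
    linarith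
  have htlt : (t : ℝ) < b := lt_of_le_of_ne t.2.2 htb
  refine measurable_of_Iio fun α => ?_
  -- By right-continuity, `w t < α` means that `w` stays below some rational `β < α` on a short
  -- interval after `t`. The interval is open, so exceeding `β` somewhere in it survives a small
  -- time change; each set on the right is therefore closed.
  have hset : (fun w : Cadlag a b => w t) ⁻¹' Iio α = ⋃ β : {q : ℚ // (q : ℝ) < α}, ⋃ k : ℕ,
      {w : Cadlag a b | ∀ s : Icc a b, t < s → (s : ℝ) < t + 1 / ((k : ℝ) + 1) →
        w s ≤ (β : ℚ)} := by
    ext w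
    simp only [mem_preimage, mem_Iio, mem_iUnion, mem_ofPred_eq]
    constructor
    · intro hw
      obtain ⟨β, hβ1, hβ2⟩ := exists_rat_btwn hw
      obtain ⟨d, hd, h⟩ := Metric.continuousWithinAt_iff.1 (w.isCadlag t).1 (β - w t) (by linarith)
      obtain ⟨k, hk⟩ := exists_nat_one_div_lt hd
      refine ⟨⟨β, hβ2⟩, k, fun s hts hs => ?_⟩
      have hts' : (t : ℝ) < s := hts
      have := h (x := s) hts.le (by
        rw [Subtype.dist_eq, Real.dist_eq, abs_lt]; constructor <;> linarith)
      rw [Real.dist_eq, abs_lt] at this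
      change w s ≤ (β : ℝ)
      linarith
    · rintro ⟨⟨β, hβ⟩, k, h⟩
      refine lt_of_le_of_lt ?_ hβ
      have hne : (𝓝[>] t).NeBot :=
        nhdsGT_neBot_of_exists_gt ⟨⟨b, t.2.1.trans t.2.2, le_rfl⟩, htlt⟩
      have hlim : Tendsto w (𝓝[>] t) (𝓝 (w t)) :=
        (w.isCadlag t).1.tendsto.mono_left (nhdsWithin_mono t Ioi_subset_Ici_self)
      refine le_of_tendsto hlim ?_
      have hev : ∀ᶠ s : Icc a b in 𝓝[>] t, (s : ℝ) < t + 1 / ((k : ℝ) + 1) := by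
        refine nhdsWithin_le_nhds (continuous_subtype_val.continuousAt.eventually_lt
          continuousAt_const ?_)
        have : 0 < 1 / ((k : ℝ) + 1) := by positivity
        linarith
      filter_upwards [hev, self_mem_nhdsWithin] with s hs hts
      exact h s hts hs
  rw [hset]
  refine MeasurableSet.iUnion fun β => MeasurableSet.iUnion fun k => IsClosed.measurableSet ?_
  rw [← isOpen_compl_iff, Metric.isOpen_iff]
  intro w hw
  simp only [mem_compl_iff, mem_ofPred_eq, not_forall, not_le] at hw
  obtain ⟨s, hts, hs, hws⟩ := hw
  have hts' : (t : ℝ) < s := hts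
  obtain ⟨δ, hδ, h1, h2, h3⟩ : ∃ δ > 0, δ < (s : ℝ) - t ∧ δ < t + 1 / ((k : ℝ) + 1) - s ∧
      δ < w s - (β : ℚ) := by
    obtain ⟨δ, h0, h⟩ := exists_between (show (0 : ℝ) < min ((s : ℝ) - t)
      (min (t + 1 / ((k : ℝ) + 1) - s) (w s - (β : ℚ))) from
        lt_min (by linarith) (lt_min (by linarith) (by linarith)))
    simp only [lt_min_iff] at h
    exact ⟨δ, h0, h⟩
  refine ⟨min δ 1, by positivity, fun w' hw' => ?_⟩
  rw [Metric.mem_ball, dist_comm] at hw'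
  obtain ⟨f, hf1, hf2⟩ := exists_orderIso_of_dist_lt' hw'
  have e1 := abs_le.1 (hf1 s)
  have e2 := abs_le.1 (hf2 s)
  simp only [mem_compl_iff, mem_ofPred_eq, not_forall, not_le]
  exact ⟨f s, show (t : ℝ) < f s by linarith, by linarith, by linarith⟩

end Cadlag

/-! ### Integer valued measures as finite sums of Dirac masses, and matching of their atoms. -/

section SumDirac

variable {X : Type*} [MeasurableSpace X]

theorem sum_dirac_apply {ι : Type*} [Fintype ι] (z : ι → X) {A : Set X} (hA : MeasurableSet A) :
    (∑ i, Measure.dirac (z i)) A = ∑ i, A.indicator 1 (z i) := by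
  rw [Measure.finsetSum_apply]
  exact Finset.sum_congr rfl fun i _ => Measure.dirac_apply' _ hA

theorem notMem_of_sum_dirac_eq_zero {ι : Type*} [Fintype ι] {z : ι → X} {A : Set X}
    (hA : MeasurableSet A) (h : (∑ i, Measure.dirac (z i)) A = 0) (i : ι) : z i ∉ A := by
  rw [sum_dirac_apply z hA, Finset.sum_eq_zero_iff] at h
  intro hi
  simpa [hi] using h i (Finset.mem_univ i)

theorem sum_dirac_eq_zero_iff {ι : Type*} [Fintype ι] {z : ι → X} {A : Set X}
    (hA : MeasurableSet A) : (∑ i, Measure.dirac (z i)) A = 0 ↔ ∀ i, z i ∉ A := by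
  refine ⟨fun h => notMem_of_sum_dirac_eq_zero hA h, fun h => ?_⟩
  rw [sum_dirac_apply z hA]
  exact Finset.sum_eq_zero fun i _ => indicator_of_notMem (h i) _

end SumDirac

section IntegerValued

variable {X : Type*} [MetricSpace X] [SecondCountableTopology X] [MeasurableSpace X] [BorelSpace X]

theorem one_le_of_nat_of_ne_zero {r : ℝ≥0∞} (h : ∃ k : ℕ, r = k) (h0 : r ≠ 0) : 1 ≤ r := by
  obtain ⟨k, rfl⟩ := h
  exact_mod_cast Nat.one_le_iff_ne_zero.2 (by exact_mod_cast h0)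

/-- A nonzero integer valued measure has an atom. -/
theorem exists_atom {ν : Measure X} (hν : ∀ A, MeasurableSet A → ∃ k : ℕ, ν A = k) (h0 : ν ≠ 0) :
    ∃ x, 1 ≤ ν {x} := by
  -- Every ball around a point of the support has positive, hence at least unit, mass; this passes
  -- to the limit as the balls shrink to the point.
  obtain ⟨x, hx⟩ := ν.nonempty_support h0
  refine ⟨x, ?_⟩
  have hfin : ∀ A, MeasurableSet A → ν A ≠ ∞ := fun A hA => by
    obtain ⟨k, hk⟩ := hν A hA
    rw [hk]; exact ENNReal.natCast_ne_top k
  have hanti : Antitone fun n : ℕ => Metric.ball x (1 / ((n : ℝ) + 1)) := fun n k hnk =>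
    Metric.ball_subset_ball (one_div_le_one_div_of_le (by positivity) (by gcongr))
  have hinter : ⋂ n : ℕ, Metric.ball x (1 / ((n : ℝ) + 1)) = {x} := by
    ext y
    simp only [mem_iInter, Metric.mem_ball, mem_singleton_iff]
    refine ⟨fun h => dist_le_zero.1 (ge_of_tendsto' tendsto_one_div_add_atTop_nhds_zero_nat
      fun n => (h n).le), ?_⟩
    rintro rfl n
    rw [dist_self]; positivity
  have hlim := tendsto_measure_iInter_atTop
    (fun n : ℕ => (Metric.isOpen_ball (x := x)
      (ε := 1 / ((n : ℝ) + 1))).measurableSet.nullMeasurableSet (μ := ν)) hanti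
    ⟨0, hfin _ Metric.isOpen_ball.measurableSet⟩
  rw [hinter] at hlim
  refine ge_of_tendsto' hlim fun n => one_le_of_nat_of_ne_zero
    (hν _ Metric.isOpen_ball.measurableSet) (ne_of_gt ?_)
  exact ν.mem_support_iff_forall x |>.1 hx _ (Metric.ball_mem_nhds x (by positivity))

/-- An integer valued measure of finite mass is a finite sum of Dirac measures. -/
theorem exists_eq_sum_dirac {ι : Type*} [Fintype ι] {ν : Measure X}
    (hν : ∀ A, MeasurableSet A → ∃ k : ℕ, ν A = k) (hcard : ν univ = Fintype.card ι) :
    ∃ z : ι → X, ν = ∑ i, Measure.dirac (z i) := by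
  suffices ∀ (n : ℕ) (ν : Measure X), (∀ A, MeasurableSet A → ∃ k : ℕ, ν A = k) →
      ν univ = n → ∃ z : Fin n → X, ν = ∑ i, Measure.dirac (z i) by
    obtain ⟨z, hz⟩ := this _ ν hν hcard
    exact ⟨z ∘ Fintype.equivFin ι, by
      rw [hz]; exact ((Fintype.equivFin ι).sum_comp fun i => Measure.dirac (z i)).symm⟩
  clear hν hcard ν
  intro n
  induction n with
  | zero =>
    intro ν _ h
    refine ⟨Fin.elim0, ?_⟩
    rw [Finset.univ_eq_empty, Finset.sum_empty]
    exact Measure.measure_univ_eq_zero.1 (by simpa using h)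
  | succ n ih =>
    intro ν hν hn
    have h0 : ν ≠ 0 := by
      rintro rfl
      rw [Measure.coe_zero, Pi.zero_apply] at hn
      exact absurd hn.symm (by exact_mod_cast Nat.succ_ne_zero n)
    obtain ⟨x, hx⟩ := exists_atom hν h0
    obtain ⟨k, hk⟩ := hν {x} (measurableSet_singleton x)
    obtain ⟨j, rfl⟩ : ∃ j, k = j + 1 := by
      rw [hk] at hx
      exact ⟨k - 1, by have : 1 ≤ k := by exact_mod_cast hx
                       omega⟩
    -- This is `ν` with one unit of mass removed at `x`, written without subtracting measures.
    let ν' : Measure X := ν.restrict {x}ᶜ + (j : ℝ≥0∞) • Measure.dirac x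
    have hadd : ν = Measure.dirac x + ν' := by
      conv_lhs => rw [← Measure.restrict_add_restrict_compl (μ := ν) (measurableSet_singleton x),
        Measure.restrict_singleton, hk]
      simp only [ν']
      push_cast
      rw [add_smul, one_smul]
      abel
    obtain ⟨z, hz⟩ := ih ν' (fun A hA => by
        obtain ⟨i, hi⟩ := hν (A ∩ {x}ᶜ) (hA.inter (measurableSet_singleton x).compl)
        classical
        refine ⟨i + j * (if x ∈ A then 1 else 0), ?_⟩
        simp only [ν', Measure.add_apply, Measure.smul_apply, Measure.restrict_apply hA, hi,
          Measure.dirac_apply' x hA, indicator_apply, smul_eq_mul, Pi.one_apply]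
        push_cast
        rfl) (by
        have := congrArg (fun m : Measure X => m univ) hadd
        simp only [Measure.add_apply, measure_univ, hn] at this
        push_cast at this
        rw [add_comm] at this
        exact ((ENNReal.add_right_inj ENNReal.one_ne_top).1 this).symm)
    refine ⟨Fin.cons x z, ?_⟩
    rw [Fin.sum_univ_succ, hadd, hz]
    simp

/-- If integer valued measures have eventually the same mass as `∑ i, dirac (z i)`, both in total
and near each `z i`, then their atoms converge to the points `z i`. -/
theorem eventually_exists_eq_sum_dirac {α ι : Type*} [Fintype ι] {l : Filter α}
    {νn : α → Measure X} {z : ι → X}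
    (hνn : ∀ᶠ n in l, ∀ A, MeasurableSet A → ∃ k : ℕ, νn n A = k)
    (huniv : ∀ᶠ n in l, νn n univ = (∑ i, Measure.dirac (z i)) univ)
    (hB : ∀ i, ∀ r > 0, ∃ B, MeasurableSet B ∧ z i ∈ B ∧ B ⊆ Metric.ball (z i) r ∧
      ∀ᶠ n in l, νn n B = (∑ i, Measure.dirac (z i)) B) {η : ℝ} (hη : 0 < η) :
    ∀ᶠ n in l, ∃ z' : ι → X, νn n = ∑ i, Measure.dirac (z' i) ∧ ∀ i, dist (z' i) (z i) < η := by
  classical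
  -- Equal atoms are grouped: neighbourhoods are indexed by the distinct points, and the fibres of
  -- `zr` record the multiplicities.
  let zr : ι → range z := rangeFactorization z
  obtain ⟨r, hr0, hrη, hsep⟩ : ∃ r > 0, r < η ∧ ∀ i j, z i ≠ z j → 2 * r < dist (z i) (z j) := by
    have h1 : ∀ᶠ r : ℝ in 𝓝[>] 0, ∀ i j, z i ≠ z j → 2 * r < dist (z i) (z j) := by
      simp only [eventually_all]
      intro i j hij
      have : Tendsto (fun r : ℝ => 2 * r) (𝓝[>] 0) (𝓝 (2 * 0)) :=
        (continuous_const.mul continuous_id).continuousAt.tendsto.mono_left nhdsWithin_le_nhds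
      rw [mul_zero] at this
      exact this.eventually (gt_mem_nhds (dist_pos.2 hij))
    have h2 : ∀ᶠ r : ℝ in 𝓝[>] 0, r ∈ Ioo 0 η := Ioo_mem_nhdsGT hη
    obtain ⟨r, h, h'⟩ := (h1.and h2).exists
    exact ⟨r, h'.1, h'.2, h⟩
  have hB' : ∀ x : range z, ∃ B, MeasurableSet B ∧ x.1 ∈ B ∧ B ⊆ Metric.ball x.1 r ∧
      ∀ᶠ n in l, νn n B = (∑ i, Measure.dirac (z i)) B := by
    rintro ⟨_, i, rfl⟩
    exact hB i r hr0
  choose B hBm hzB hBr hBn using hB'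
  have hdisj : Pairwise fun x y => Disjoint (B x) (B y) := by
    rintro ⟨_, i, rfl⟩ ⟨_, j, rfl⟩ hij
    refine Disjoint.mono (hBr _) (hBr _) (Metric.ball_disjoint_ball ?_)
    have := hsep i j fun h => hij (Subtype.ext h)
    change r + r ≤ dist (z i) (z j)
    linarith
  have hmass : ∀ x, (∑ i, Measure.dirac (z i)) (B x) = Fintype.card {i // zr i = x} := by
    intro x
    rw [sum_dirac_apply z (hBm x), Fintype.card_subtype, Finset.card_eq_sum_ones, Finset.sum_filter]
    push_cast
    refine Finset.sum_congr rfl fun i _ => ?_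
    by_cases hi : zr i = x
    · have : z i ∈ B x := by rw [← hi]; exact hzB (zr i)
      simp [hi, this]
    · have : z i ∉ B x := fun h => disjoint_left.1 (hdisj hi) (hzB (zr i)) h
      simp [hi, this]
  filter_upwards [hνn, huniv, eventually_all.2 hBn] with n hint hu hBn
  -- The disjoint sets `B x` carry the entire mass of the limit, hence also that of `νn n`, so no
  -- atom lies elsewhere.
  have hdec : νn n = ∑ x, (νn n).restrict (B x) := by
    have hfin : νn n univ ≠ ∞ := by
      obtain ⟨k, hk⟩ := hint univ MeasurableSet.univ
      rw [hk]; exact ENNReal.natCast_ne_top k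
    have : IsFiniteMeasure (νn n) := ⟨hfin.lt_top⟩
    have hUm : MeasurableSet (⋃ x, B x) := MeasurableSet.iUnion hBm
    have hmassU : νn n (⋃ x, B x) = νn n univ := by
      rw [measure_iUnion hdisj hBm, tsum_fintype, hu, ← Measure.restrict_univ
        (μ := ∑ i, Measure.dirac (z i))]
      simp only [hBn, Measure.restrict_univ]
      rw [← tsum_fintype (L := .unconditional _), ← measure_iUnion hdisj hBm, sum_dirac_apply z hUm,
        sum_dirac_apply z MeasurableSet.univ]
      refine Finset.sum_congr rfl fun i _ => ?_
      have hi : z i ∈ ⋃ x, B x := mem_iUnion.2 ⟨zr i, hzB (zr i)⟩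
      rw [indicator_of_mem hi, indicator_of_mem (mem_univ _)]
    have hc : νn n (⋃ x, B x)ᶜ = 0 := by
      rw [measure_compl hUm (measure_ne_top _ _), hmassU, tsub_self]
    rw [← Measure.sum_fintype, ← Measure.restrict_iUnion hdisj hBm]
    exact (Measure.restrict_eq_self_of_ae_mem (by rw [ae_iff]; exact hc)).symm
  have hloc : ∀ x, ∃ w : {i // zr i = x} → X, (νn n).restrict (B x) = ∑ i, Measure.dirac (w i) := by
    intro x
    refine exists_eq_sum_dirac (fun A hA => ?_) ?_
    · rw [Measure.restrict_apply hA]; exact hint _ (hA.inter (hBm x))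
    · rw [Measure.restrict_apply_univ, hBn, hmass]
  choose w hw using hloc
  refine ⟨fun i => w (zr i) ⟨i, rfl⟩, ?_, fun i => ?_⟩
  · rw [hdec, ← (Equiv.sigmaFiberEquiv zr).sum_comp, Fintype.sum_sigma]
    refine Finset.sum_congr rfl fun x _ => ?_
    rw [hw x]
    refine Finset.sum_congr rfl ?_
    rintro ⟨i, rfl⟩ _
    rfl
  · have hz : w (zr i) ⟨i, rfl⟩ ∉ (B (zr i))ᶜ := by
      refine notMem_of_sum_dirac_eq_zero (hBm _).compl ?_ _
      rw [← hw, Measure.restrict_apply (hBm _).compl, compl_inter_self, measure_empty]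
    exact (Metric.mem_ball.1 (hBr _ (not_not.1 hz))).trans hrη

end IntegerValued

/-! ### Test functions and the masses of continuity sets. -/

section TestFunctions

variable {X : Type*} [MetricSpace X]

/-- A continuous function which is `1` on `B` and vanishes off its `1 / (k + 1)` thickening. -/
noncomputable def outerTest (B : Set X) (k : ℕ) : X →ᵇ ℝ :=
  BoundedContinuousFunction.ofNormedAddCommGroup
    (fun x => (thickenedIndicator (Nat.one_div_pos_of_nat (n := k) (α := ℝ)) B x : ℝ))
    (by fun_prop) 1 (fun x => by
      rw [NNReal.norm_eq]; exact_mod_cast thickenedIndicator_le_one _ B x)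

/-- A continuous function vanishing off `B`, which is `1` off the `1 / (k + 1)` thickening of the
complement of `B`. -/
noncomputable def innerTest (B : Set X) (k : ℕ) : X →ᵇ ℝ := 1 - outerTest Bᶜ k

theorem outerTest_apply (B : Set X) (k : ℕ) (x : X) : outerTest B k x =
    (thickenedIndicator (Nat.one_div_pos_of_nat (n := k) (α := ℝ)) B x : ℝ) := rfl

theorem innerTest_apply (B : Set X) (k : ℕ) (x : X) : innerTest B k x = 1 - outerTest Bᶜ k x := rfl

theorem outerTest_nonneg (B : Set X) (k : ℕ) (x : X) : 0 ≤ outerTest B k x := NNReal.coe_nonneg _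

theorem outerTest_le_one (B : Set X) (k : ℕ) (x : X) : outerTest B k x ≤ 1 := by
  rw [outerTest_apply]; exact_mod_cast thickenedIndicator_le_one _ B x

theorem outerTest_eq_one {B : Set X} (k : ℕ) {x : X} (hx : x ∈ B) : outerTest B k x = 1 := by
  rw [outerTest_apply, thickenedIndicator_one _ B hx, NNReal.coe_one]

theorem support_outerTest_subset (B : Set X) (k : ℕ) :
    Function.support (outerTest B k) ⊆ Metric.thickening 1 B := by
  intro x hx
  by_contra h
  refine hx ?_
  rw [outerTest_apply, thickenedIndicator_zero _ B fun h' => h (Metric.thickening_mono ?_ B h'),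
    NNReal.coe_zero]
  rw [div_le_one (by positivity)]
  simp

theorem support_innerTest_subset (B : Set X) (k : ℕ) : Function.support (innerTest B k) ⊆ B := by
  intro x hx
  by_contra h
  refine hx ?_
  rw [innerTest_apply, outerTest_eq_one k (show x ∈ Bᶜ from h), sub_self]

theorem tendsto_outerTest (B : Set X) (x : X) :
    Tendsto (fun k => outerTest B k x) atTop (𝓝 ((closure B).indicator 1 x)) := by
  have h := thickenedIndicator_tendsto_indicator_closure
    (fun k => Nat.one_div_pos_of_nat (n := k) (α := ℝ)) tendsto_one_div_add_atTop_nhds_zero_nat B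
  have h2 := (NNReal.continuous_coe.tendsto _).comp ((tendsto_pi_nhds.1 h) x)
  refine (h2.congr fun k => rfl).trans_eq ?_
  by_cases hx : x ∈ closure B <;> simp [hx]

theorem tendsto_innerTest (B : Set X) (x : X) :
    Tendsto (fun k => innerTest B k x) atTop (𝓝 ((interior B).indicator 1 x)) := by
  have h := (tendsto_const_nhds (x := (1 : ℝ))).sub (tendsto_outerTest Bᶜ x)
  refine h.trans_eq ?_
  rw [closure_compl]
  by_cases hx : x ∈ interior B <;> simp [hx]

theorem isBounded_support_outerTest {B : Set X} (hB : Bornology.IsBounded B) (k : ℕ) :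
    Bornology.IsBounded (Function.support (outerTest B k)) :=
  hB.thickening.subset (support_outerTest_subset B k)

theorem isBounded_support_innerTest {B : Set X} (hB : Bornology.IsBounded B) (k : ℕ) :
    Bornology.IsBounded (Function.support (innerTest B k)) :=
  hB.subset (support_innerTest_subset B k)

/-- A countable family of bounded open sets containing `U` and arbitrarily small neighbourhoods of
each point. -/
theorem exists_testSets [SecondCountableTopology X] {U : Set X} (hUo : IsOpen U)
    (hU : Bornology.IsBounded U) :
    ∃ B : ℕ → Set X, (∀ j, Bornology.IsBounded (B j)) ∧ (∀ j, IsOpen (B j)) ∧ B 0 = U ∧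
      ∀ x, ∀ r > 0, ∃ j, x ∈ B j ∧ closure (B j) ⊆ Metric.ball x r := by
  rcases isEmpty_or_nonempty X with hX | hX
  · exact ⟨fun _ => U, fun _ => hU, fun _ => hUo, rfl, fun x => (hX.false x).elim⟩
  let B : ℕ → Set X := fun j => Nat.casesOn j U fun n =>
    Metric.ball (TopologicalSpace.denseSeq X n.unpair.1) (1 / ((n.unpair.2 : ℝ) + 1))
  refine ⟨B, fun j => ?_, fun j => ?_, rfl, fun x r hr => ?_⟩
  · cases j
    · exact hU
    · exact Metric.isBounded_ball
  · cases j
    · exact hUo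
    · exact Metric.isOpen_ball
  · obtain ⟨k, hk⟩ := exists_nat_one_div_lt (half_pos hr)
    obtain ⟨i, hi⟩ := (TopologicalSpace.denseRange_denseSeq X).exists_dist_lt x
      (show 0 < 1 / ((k : ℝ) + 1) by positivity)
    refine ⟨Nat.pair i k + 1, ?_, ?_⟩
    · simpa [B] using hi
    · simp only [B, Nat.unpair_pair]
      refine Metric.closure_ball_subset_closedBall.trans fun y hy => ?_
      rw [Metric.mem_closedBall] at hy
      rw [Metric.mem_ball]
      have := dist_triangle y (TopologicalSpace.denseSeq X i) x
      rw [dist_comm (TopologicalSpace.denseSeq X i) x] at this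
      linarith

variable [MeasurableSpace X]

/-- The integrals of a countable family of test functions. -/
noncomputable def testIntegrals (B : ℕ → Set X) (m : BddFinMeasure X) : ℕ × ℕ → ℝ × ℝ :=
  fun p => (∫ x, outerTest (B p.1) p.2 x ∂m.1, ∫ x, innerTest (B p.1) p.2 x ∂m.1)

theorem BddFinMeasure.continuous_integral (f : X →ᵇ ℝ)
    (hf : Bornology.IsBounded (Function.support f)) :
    Continuous fun m : BddFinMeasure X => ∫ x, f x ∂m.1 :=
  (continuous_apply (⟨f, hf⟩ : {f : X →ᵇ ℝ // Bornology.IsBounded (Function.support f)})).comp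
    (continuous_induced_dom (f := fun (μ : BddFinMeasure X)
      (f : {f : X →ᵇ ℝ // Bornology.IsBounded (Function.support f)}) => ∫ x, f.1 x ∂μ.1))

theorem continuous_testIntegrals {B : ℕ → Set X} (hB : ∀ j, Bornology.IsBounded (B j)) :
    Continuous (testIntegrals B) :=
  continuous_pi fun p => (BddFinMeasure.continuous_integral _
    (isBounded_support_outerTest (hB p.1) p.2)).prodMk (BddFinMeasure.continuous_integral _
    (isBounded_support_innerTest (hB p.1) p.2))

variable [BorelSpace X]

theorem BddFinMeasure.measure_lt_top (m : BddFinMeasure X) {B : Set X}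
    (hB : Bornology.IsBounded B) : m.1 B < ∞ :=
  (measure_mono subset_closure).trans_lt
    (m.2 _ isClosed_closure.measurableSet hB.closure)

theorem integrable_of_isBounded_support (m : BddFinMeasure X) (f : X →ᵇ ℝ)
    (hf : Bornology.IsBounded (Function.support f)) : Integrable f m.1 := by
  rw [← integrableOn_iff_integrable_of_support_subset (Subset.rfl : Function.support f ⊆ _)]
  have : IsFiniteMeasure (m.1.restrict (Function.support f)) :=
    ⟨by rw [Measure.restrict_apply_univ]; exact m.measure_lt_top hf⟩
  exact f.integrable _

theorem tendsto_integral_outerTest (m : BddFinMeasure X) {B : Set X}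
    (hB : Bornology.IsBounded B) :
    Tendsto (fun k => ∫ x, outerTest B k x ∂m.1) atTop (𝓝 (m.1.real (closure B))) := by
  rw [← integral_indicator_one isClosed_closure.measurableSet]
  refine tendsto_integral_of_dominated_convergence ((Metric.thickening 1 B).indicator 1)
    (fun k => (outerTest B k).continuous.measurable.aestronglyMeasurable) ?_ (fun k => ?_)
    (Eventually.of_forall (tendsto_outerTest B))
  · exact (integrable_indicator_iff Metric.isOpen_thickening.measurableSet).2
      (integrableOn_const (m.measure_lt_top hB.thickening).ne)
  · refine Eventually.of_forall fun x => ?_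
    rw [Real.norm_of_nonneg (outerTest_nonneg B k x)]
    by_cases hx : x ∈ Metric.thickening 1 B
    · rw [indicator_of_mem hx]; exact outerTest_le_one B k x
    · rw [indicator_of_notMem hx, Function.notMem_support.1 fun h =>
        hx (support_outerTest_subset B k h)]

theorem tendsto_integral_innerTest (m : BddFinMeasure X) {B : Set X}
    (hB : Bornology.IsBounded B) :
    Tendsto (fun k => ∫ x, innerTest B k x ∂m.1) atTop (𝓝 (m.1.real (interior B))) := by
  rw [← integral_indicator_one isOpen_interior.measurableSet]
  refine tendsto_integral_of_dominated_convergence ((closure B).indicator 1)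
    (fun k => (innerTest B k).continuous.measurable.aestronglyMeasurable) ?_ (fun k => ?_)
    (Eventually.of_forall (tendsto_innerTest B))
  · exact (integrable_indicator_iff isClosed_closure.measurableSet).2
      (integrableOn_const (m.measure_lt_top hB.closure).ne)
  · refine Eventually.of_forall fun x => ?_
    have h0 := outerTest_nonneg Bᶜ k x
    have h1 := outerTest_le_one Bᶜ k x
    rw [Real.norm_of_nonneg (by rw [innerTest_apply]; linarith)]
    by_cases hx : x ∈ closure B
    · rw [indicator_of_mem hx, innerTest_apply, Pi.one_apply]; linarith
    · rw [indicator_of_notMem hx, Function.notMem_support.1 fun h =>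
        hx (subset_closure (support_innerTest_subset B k h))]

theorem measureReal_le_integral_outerTest (m : BddFinMeasure X) {B : Set X}
    (hBm : MeasurableSet B) (hB : Bornology.IsBounded B) (k : ℕ) :
    m.1.real B ≤ ∫ x, outerTest B k x ∂m.1 := by
  rw [← integral_indicator_one hBm]
  refine integral_mono ((integrable_indicator_iff hBm).2
    (integrableOn_const (m.measure_lt_top hB).ne))
    (integrable_of_isBounded_support m _ (isBounded_support_outerTest hB k)) fun x => ?_
  by_cases hx : x ∈ B
  · simp only [indicator_of_mem hx, outerTest_eq_one k hx, Pi.one_apply, le_refl]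
  · simp only [indicator_of_notMem hx]; exact outerTest_nonneg B k x

theorem integral_innerTest_le_measureReal (m : BddFinMeasure X) {B : Set X}
    (hBm : MeasurableSet B) (hB : Bornology.IsBounded B) (k : ℕ) :
    ∫ x, innerTest B k x ∂m.1 ≤ m.1.real B := by
  rw [← integral_indicator_one hBm]
  refine integral_mono (integrable_of_isBounded_support m _ (isBounded_support_innerTest hB k))
    ((integrable_indicator_iff hBm).2
    (integrableOn_const (m.measure_lt_top hB).ne)) fun x => ?_
  by_cases hx : x ∈ B
  · simp only [indicator_of_mem hx, Pi.one_apply, innerTest_apply]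
    linarith [outerTest_nonneg Bᶜ k x]
  · simp only [indicator_of_notMem hx]
    rw [Function.notMem_support.1 fun h => hx (support_innerTest_subset B k h)]

/-- Convergence of point measures along the test functions forces the masses of a continuity set
to agree eventually. -/
theorem eventually_measure_eq {α : Type*} {l : Filter α} {B : Set X} (hBm : MeasurableSet B)
    (hB : Bornology.IsBounded B) {m : BddFinMeasure X} {mn : α → BddFinMeasure X}
    (hm : m ∈ pointMeasures X) (hmn : ∀ᶠ n in l, mn n ∈ pointMeasures X)
    (hfr : m.1 (frontier B) = 0)
    (hout : ∀ k, Tendsto (fun n => ∫ x, outerTest B k x ∂(mn n).1) l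
      (𝓝 (∫ x, outerTest B k x ∂m.1)))
    (hin : ∀ k, Tendsto (fun n => ∫ x, innerTest B k x ∂(mn n).1) l
      (𝓝 (∫ x, innerTest B k x ∂m.1))) :
    ∀ᶠ n in l, (mn n).1 B = m.1 B := by
  obtain ⟨N, hN⟩ := hm B hBm hB
  have hNr : m.1.real B = N := by rw [measureReal_def, hN, ENNReal.toReal_natCast]
  have h1 := tendsto_integral_outerTest m hB
  have h2 := tendsto_integral_innerTest m hB
  rw [measureReal_def, measure_closure_of_null_frontier hfr, ← measureReal_def, hNr] at h1
  rw [measureReal_def, measure_interior_of_null_frontier hfr, ← measureReal_def, hNr] at h2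
  -- One outer and one inner test function suffice: the mass of `B` under `mn n` is an integer
  -- strictly between `N - 1` and `N + 1`.
  obtain ⟨k₁, hk₁⟩ := (h1.eventually (gt_mem_nhds (show (N : ℝ) < N + 1 by linarith))).exists
  obtain ⟨k₂, hk₂⟩ := (h2.eventually (lt_mem_nhds (show (N : ℝ) - 1 < N by linarith))).exists
  filter_upwards [hmn, (hout k₁).eventually (gt_mem_nhds hk₁),
    (hin k₂).eventually (lt_mem_nhds hk₂)] with n hn e1 e2
  obtain ⟨K, hK⟩ := hn B hBm hB
  have hKr : (mn n).1.real B = K := by rw [measureReal_def, hK, ENNReal.toReal_natCast]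
  have e3 := measureReal_le_integral_outerTest (mn n) hBm hB k₁
  have e4 := integral_innerTest_le_measureReal (mn n) hBm hB k₂
  rw [hKr] at e3 e4
  have e5 : K < N + 1 := by exact_mod_cast e3.trans_lt e1
  have e6 : N < K + 1 := by
    have : (N : ℝ) < K + 1 := by linarith
    exact_mod_cast this
  rw [hN, hK, show K = N by omega]

end TestFunctions

/-! ### Sums over the atoms in a bounded open set, and their continuity. -/

section RestrictedSum

variable {X : Type*} [MetricSpace X] [MeasurableSpace X] {a b : ℝ}

/-- The sum `∫_U c(p) m(dp)` of càdlàg functions, the integral being taken pointwise. -/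
noncomputable def restrictedSum (U : Set X) (c : X → Cadlag a b) (m : Measure X) : Cadlag a b :=
  Cadlag.ofFun fun t => ∫ p in U, c p t ∂m

theorem Cadlag.ofFun_coe (x : Cadlag a b) : Cadlag.ofFun x.toFun = x := by
  rw [Cadlag.ofFun, dif_pos x.isCadlag]

variable [BorelSpace X]

theorem integral_sum_dirac_eq {ι : Type*} [Fintype ι] (z : ι → X) (f : X → ℝ) :
    ∫ p, f p ∂(∑ i, Measure.dirac (z i)) = ∑ i, f (z i) := by
  rw [integral_finsetSum_measure fun i _ => integrable_dirac (by simp)]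
  exact Finset.sum_congr rfl fun i _ => integral_dirac _ _

theorem integrable_sum_dirac_measure {ι : Type*} [Fintype ι] (z : ι → X) (f : X → ℝ) :
    Integrable f (∑ i, Measure.dirac (z i)) :=
  integrable_finsetSum_measure.2 fun i _ => integrable_dirac (by simp)

/-- The pointwise integral against finitely many Dirac masses is a finite sum of càdlàg functions,
so the default value in `Cadlag.ofFun` never intervenes. -/
theorem restrictedSum_eq_sum {ι : Type*} [Fintype ι] {U : Set X} {c : X → Cadlag a b}
    {m : Measure X} {z : ι → X} (hz : m.restrict U = ∑ i, Measure.dirac (z i)) :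
    restrictedSum U c m = ∑ i, c (z i) := by
  rw [← Cadlag.ofFun_coe (∑ i, c (z i)), restrictedSum]
  congr 1
  funext t
  rw [hz, integral_sum_dirac_eq, Cadlag.sum_apply]

theorem exists_restrict_eq_sum_dirac [SecondCountableTopology X] {U : Set X}
    (hUm : MeasurableSet U) (hU : Bornology.IsBounded U) {m : BddFinMeasure X}
    (hm : m ∈ pointMeasures X) :
    ∃ (n : ℕ) (z : Fin n → X), m.1.restrict U = ∑ i, Measure.dirac (z i) := by
  obtain ⟨n, hn⟩ := hm U hUm hU
  refine ⟨n, exists_eq_sum_dirac (fun A hA => ?_) ?_⟩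
  · rw [Measure.restrict_apply hA]
    exact hm _ (hA.inter hUm) (hU.subset inter_subset_right)
  · rw [Measure.restrict_apply_univ, hn, Fintype.card_fin]

theorem restrictedSum_apply [SecondCountableTopology X] {U : Set X} (c : X → Cadlag a b)
    (hUm : MeasurableSet U) (hU : Bornology.IsBounded U) {m : BddFinMeasure X}
    (hm : m ∈ pointMeasures X) (t : Icc a b) :
    IntegrableOn (fun p => c p t) U m.1 ∧
      restrictedSum U c m.1 t = ∫ p in U, c p t ∂m.1 := by
  obtain ⟨n, z, hz⟩ := exists_restrict_eq_sum_dirac hUm hU hm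
  refine ⟨?_, ?_⟩
  · rw [IntegrableOn, hz]; exact integrable_sum_dirac_measure z _
  · rw [restrictedSum_eq_sum hz, hz, integral_sum_dirac_eq, Cadlag.sum_apply]

/-- Continuity of the summation map at point measures whose atoms are sent to functions without
common discontinuities. -/
theorem tendsto_restrictedSum [SecondCountableTopology X] {U : Set X} (hUo : IsOpen U)
    (hU : Bornology.IsBounded U) {c : X → Cadlag a b} (hc : ContinuousOn c U) {B : ℕ → Set X}
    (hBb : ∀ j, Bornology.IsBounded (B j)) (hBo : ∀ j, IsOpen (B j)) (hB0 : B 0 = U)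
    (hBs : ∀ x, ∀ r > 0, ∃ j, x ∈ B j ∧ closure (B j) ⊆ Metric.ball x r)
    {α ι : Type*} [Fintype ι] {l : Filter α} {m : BddFinMeasure X} {mn : α → BddFinMeasure X}
    (hm : m ∈ pointMeasures X) (hmn : ∀ᶠ n in l, mn n ∈ pointMeasures X)
    (hfr : m.1 (frontier U) = 0) {z : ι → X} (hz : m.1.restrict U = ∑ i, Measure.dirac (z i))
    (hdisc : Pairwise fun i j => Disjoint (c (z i)).Disc (c (z j)).Disc)
    (hlim : Tendsto (fun n => testIntegrals B (mn n)) l (𝓝 (testIntegrals B m))) :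
    Tendsto (fun n => restrictedSum U c (mn n).1) l (𝓝 (restrictedSum U c m.1)) := by
  have hlim' := tendsto_pi_nhds.1 hlim
  have hmass : ∀ j, m.1 (frontier (B j)) = 0 → ∀ᶠ n in l, (mn n).1 (B j) = m.1 (B j) :=
    fun j hj => eventually_measure_eq (hBo j).measurableSet (hBb j) hm hmn hj
      (fun k => (continuous_fst.tendsto _).comp (hlim' (j, k)))
      (fun k => (continuous_snd.tendsto _).comp (hlim' (j, k)))
  have hzU : ∀ i, z i ∈ U := fun i => not_not.1 (notMem_of_sum_dirac_eq_zero
    hUo.measurableSet.compl (by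
      rw [← hz, Measure.restrict_apply hUo.measurableSet.compl, compl_inter_self, measure_empty]) i)
  -- Once atoms are matched, only this continuity in the positions of finitely many atoms is needed.
  have hcont : Tendsto (fun w : ι → X => ∑ i, c (w i)) (𝓝 z) (𝓝 (∑ i, c (z i))) :=
    Cadlag.tendsto_sum Finset.univ hdisc fun i _ =>
      (hc.continuousAt (hUo.mem_nhds (hzU i))).tendsto.comp ((continuous_apply i).tendsto z)
  rw [restrictedSum_eq_sum hz]
  intro V hV
  obtain ⟨η, hη, hηV⟩ := Metric.mem_nhds_iff.1 (hcont hV)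
  have hmatch := eventually_exists_eq_sum_dirac (l := l) (νn := fun n => (mn n).1.restrict U)
    (z := z) ?_ ?_ ?_ (half_pos hη)
  · rw [mem_map]
    filter_upwards [hmatch] with n ⟨z', hz', hd⟩
    rw [mem_preimage, restrictedSum_eq_sum hz']
    refine hηV (show z' ∈ _ from ?_)
    rw [Metric.mem_ball]
    exact ((dist_pi_le_iff (half_pos hη).le).2 fun i => (hd i).le).trans_lt (half_lt_self hη)
  · filter_upwards [hmn] with n hn A hA
    rw [Measure.restrict_apply hA]
    exact hn _ (hA.inter hUo.measurableSet) (hU.subset inter_subset_right)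
  · filter_upwards [hmass 0 (by rwa [hB0])] with n hn
    rw [← hz, Measure.restrict_apply_univ, Measure.restrict_apply_univ, ← hB0, hn]
  · intro i r hr
    -- The radius `s` excludes all atoms at other positions, and `s < d` keeps the closed
    -- neighbourhood inside `U`. As `B j` is open and contains `z i`, its frontier then carries no
    -- mass of `m`.
    have hev : ∀ᶠ s : ℝ in 𝓝[>] 0, (∀ j, z j ≠ z i → s < dist (z j) (z i)) ∧ s < r := by
      refine (eventually_all.2 fun j => ?_).and (nhdsWithin_le_nhds (gt_mem_nhds hr))
      by_cases h : z j = z i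
      · simp [h]
      · exact Eventually.mono (nhdsWithin_le_nhds (gt_mem_nhds (dist_pos.2 h))) fun s hs _ => hs
    obtain ⟨d, hd, hdU⟩ := Metric.isOpen_iff.1 hUo (z i) (hzU i)
    obtain ⟨s, ⟨hs1, hs2⟩, hs0, hsd⟩ := (hev.and (Ioo_mem_nhdsGT hd)).exists
    obtain ⟨j, hj, hjs⟩ := hBs (z i) s hs0
    have hjU : closure (B j) ⊆ U := (hjs.trans (Metric.ball_subset_ball hsd.le)).trans hdU
    have hrestr : ∀ μ : Measure X, μ.restrict U (B j) = μ (B j) := fun μ => by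
      rw [Measure.restrict_apply (hBo j).measurableSet,
        inter_eq_left.2 (subset_closure.trans hjU)]
    refine ⟨B j, (hBo j).measurableSet, hj, subset_closure.trans
      (hjs.trans (Metric.ball_subset_ball hs2.le)), ?_⟩
    rw [← hz]
    simp only [hrestr]
    refine hmass j ?_
    have h0 : m.1.restrict U (frontier (B j)) = 0 := by
      rw [hz, sum_dirac_eq_zero_iff isClosed_frontier.measurableSet]
      intro i' hi'
      rw [(hBo j).frontier_eq] at hi'
      have h1 := Metric.mem_ball.1 (hjs hi'.1)
      by_cases h : z i' = z i
      · exact hi'.2 (h ▸ hj)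
      · exact absurd h1 (not_lt.2 (hs1 i' h).le)
    rwa [Measure.restrict_apply isClosed_frontier.measurableSet,
      inter_eq_left.2 (frontier_subset_closure.trans hjU)] at h0

end RestrictedSum

/-! ### The summation maps on `𝒟_I` and `𝒟_I^ℓ`. -/

section SummationMap

variable {a b : ℝ}

theorem Cadlag.dist_le_one (x y : Cadlag a b) : dist x y ≤ 1 :=
  csInf_le (Cadlag.bddBelow_bounds x y) (Or.inl rfl)

/-- Consequently boundedly finite measures on `𝒟_I` are finite, and a point measure has finitely
many atoms. -/
theorem Cadlag.isBounded_set (s : Set (Cadlag a b)) : Bornology.IsBounded s :=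
  Metric.isBounded_iff.2 ⟨1, fun x _ y _ => x.dist_le_one y⟩

theorem CadlagVec.dist_le_one {ℓ : ℕ} (x y : CadlagVec a b ℓ) : dist x y ≤ 1 :=
  (dist_pi_le_iff zero_le_one).2 fun i => (x i).dist_le_one (y i)

theorem CadlagVec.isBounded_set {ℓ : ℕ} (s : Set (CadlagVec a b ℓ)) : Bornology.IsBounded s :=
  Metric.isBounded_iff.2 ⟨1, fun x _ y _ => CadlagVec.dist_le_one x y⟩

instance {ℓ : ℕ} : SecondCountableTopology (CadlagVec a b ℓ) :=
  inferInstanceAs (SecondCountableTopology (Fin ℓ → Cadlag a b))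

theorem CadlagVec.continuous_apply {ℓ : ℕ} (i : Fin ℓ) :
    Continuous fun x : CadlagVec a b ℓ => x i :=
  _root_.continuous_apply (A := fun _ : Fin ℓ => Cadlag a b) i

/-- Two atoms at distinct points with a common discontinuity give the pair `{z i, z j}` mass at
least `2`. If they sit at the same point, `hdisc` supplies another point `y` sharing a discontinuity
with it, and `{z i, y}` already has mass at least `2`. -/
theorem disjoint_of_mem_noCommonDisc {X T ι : Type*} [MetricSpace X] [MeasurableSpace X]
    [BorelSpace X] [Fintype ι] {disc : X → Set T} {m : pointMeasures X} (hm : m ∈ noCommonDisc disc)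
    (hdisc : ∀ x, (disc x).Nonempty → ∃ y, y ≠ x ∧ (disc x ∩ disc y).Nonempty) {z : ι → X}
    (hz : m.1.1 = ∑ i, Measure.dirac (z i)) :
    Pairwise fun i j => Disjoint (disc (z i)) (disc (z j)) := by
  classical
  have key : ∀ i j, i ≠ j → ∀ y, z j = z i ∨ z j = y → 2 ≤ m.1.1 {z i, y} := by
    intro i j hij y hj
    rw [hz, sum_dirac_apply z ((measurableSet_singleton y).insert _)]
    calc (2 : ℝ≥0∞) = ∑ k ∈ {i, j}, ({z i, y} : Set X).indicator 1 (z k) := by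
          rw [Finset.sum_pair hij, indicator_of_mem (by simp), indicator_of_mem (by simpa using hj)]
          norm_num
      _ ≤ _ := Finset.sum_le_sum_of_subset (Finset.subset_univ _)
  intro i j hij
  by_contra h
  rw [not_disjoint_iff_nonempty_inter] at h
  by_cases hzz : z j = z i
  · obtain ⟨y, hy, hyd⟩ := hdisc (z i) (h.mono inter_subset_left)
    exact absurd (hm (z i) y hy.symm hyd) (not_lt.2 (key i j hij y (Or.inl hzz)))
  · exact absurd (hm (z i) (z j) (Ne.symm hzz) h) (not_lt.2 (key i j hij (z j) (Or.inr rfl)))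

theorem continuousAt_restrictedSum_univ {X : Type*} [MetricSpace X] [MeasurableSpace X]
    [BorelSpace X] [SecondCountableTopology X] (hX : Bornology.IsBounded (univ : Set X))
    {c : X → Cadlag a b} (hc : Continuous c) {disc : X → Set (Icc a b)}
    (hsub : ∀ x, (c x).Disc ⊆ disc x)
    (hdisc : ∀ x, (disc x).Nonempty → ∃ y, y ≠ x ∧ (disc x ∩ disc y).Nonempty)
    {m : pointMeasures X} (hm : m ∈ noCommonDisc disc) :
    ContinuousAt (fun m : pointMeasures X => restrictedSum univ c m.1.1) m := by
  obtain ⟨B, hBb, hBo, hB0, hBs⟩ := exists_testSets isOpen_univ hX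
  obtain ⟨n, z, hz⟩ := exists_restrict_eq_sum_dirac MeasurableSet.univ hX m.2
  refine tendsto_restrictedSum isOpen_univ hX hc.continuousOn hBb hBo hB0 hBs m.2
    (Eventually.of_forall fun n => n.2) (by simp) hz (fun i j hij => ?_)
    (((continuous_testIntegrals hBb).comp continuous_subtype_val).tendsto m)
  rw [Measure.restrict_univ] at hz
  exact (disjoint_of_mem_noCommonDisc hm hdisc hz hij).mono (hsub _) (hsub _)

/-- The function `2 • x` is the second point needed to exclude repeated discontinuous atoms: it
jumps where `x` does and differs from `x`. -/
theorem Cadlag.disc_two_smul (x : Cadlag a b) : x.Disc ⊆ ((2 : ℝ) • x).Disc := by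
  have h : x = (1 / 2 : ℝ) • (2 : ℝ) • x := Cadlag.ext_fun fun t => by
    simp only [Cadlag.smul_apply]; ring
  conv_lhs => rw [h]
  exact Cadlag.disc_smul_subset _ _

theorem Cadlag.two_smul_ne {x : Cadlag a b} (hx : x.Disc.Nonempty) : (2 : ℝ) • x ≠ x := by
  intro h
  have h0 : x = 0 := Cadlag.ext_fun fun t => by
    have := congrArg (fun y : Cadlag a b => y t) h
    simp only [Cadlag.smul_apply] at this
    rw [Cadlag.zero_apply]
    linarith
  rw [h0, Cadlag.disc_zero] at hx
  exact not_nonempty_empty hx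

theorem summation_eq_restrictedSum (m : Measure (Cadlag a b)) :
    summation m = restrictedSum univ id m := by
  rw [restrictedSum, Measure.restrict_univ]; rfl

theorem summationVec_eq_restrictedSum {ℓ : ℕ} (m : Measure (CadlagVec a b ℓ)) (i : Fin ℓ) :
    summationVec m i = restrictedSum univ (fun x => x i) m := by
  rw [restrictedSum, Measure.restrict_univ]; rfl

theorem summation_apply {m : BddFinMeasure (Cadlag a b)} (hm : m ∈ pointMeasures (Cadlag a b))
    (t : Icc a b) :
    Integrable (fun w : Cadlag a b => w t) m.1 ∧ summation m.1 t = ∫ w, w t ∂m.1 := by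
  have := restrictedSum_apply id MeasurableSet.univ (Cadlag.isBounded_set univ) hm t
  rwa [← summation_eq_restrictedSum, integrableOn_univ, Measure.restrict_univ] at this

theorem summationVec_apply {ℓ : ℕ} {m : BddFinMeasure (CadlagVec a b ℓ)}
    (hm : m ∈ pointMeasures (CadlagVec a b ℓ)) (i : Fin ℓ) (t : Icc a b) :
    Integrable (fun w : CadlagVec a b ℓ => w i t) m.1 ∧
      summationVec m.1 i t = ∫ w, w i t ∂m.1 := by
  have := restrictedSum_apply (fun x : CadlagVec a b ℓ => x i) MeasurableSet.univ
    (CadlagVec.isBounded_set univ) hm t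
  rwa [← summationVec_eq_restrictedSum, integrableOn_univ, Measure.restrict_univ] at this

theorem continuousAt_summation {m : pointMeasures (Cadlag a b)}
    (hm : m ∈ noCommonDisc (Cadlag.Disc (a := a) (b := b))) :
    ContinuousAt (fun m : pointMeasures (Cadlag a b) => summation m.1.1) m := by
  simp only [summation_eq_restrictedSum]
  refine continuousAt_restrictedSum_univ (Cadlag.isBounded_set univ) continuous_id
    (fun x => Subset.rfl) (fun x hx => ⟨(2 : ℝ) • x, Cadlag.two_smul_ne hx, ?_⟩) hm
  exact (inter_eq_left.2 x.disc_two_smul).symm ▸ hx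

theorem continuousAt_summationVec {ℓ : ℕ} {m : pointMeasures (CadlagVec a b ℓ)}
    (hm : m ∈ noCommonDisc (CadlagVec.Disc (a := a) (b := b) (ℓ := ℓ))) :
    ContinuousAt (fun m : pointMeasures (CadlagVec a b ℓ) => summationVec m.1.1) m := by
  refine tendsto_pi_nhds.2 fun i => ?_
  simp only [summationVec_eq_restrictedSum]
  refine continuousAt_restrictedSum_univ (CadlagVec.isBounded_set univ)
    (CadlagVec.continuous_apply i) (disc := CadlagVec.Disc)
    (fun x => subset_iUnion (fun i => (x i).Disc) i) (fun x hx => ?_) hm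
  obtain ⟨t, ht⟩ := hx
  obtain ⟨j, hj⟩ := mem_iUnion.1 ht
  refine ⟨fun i => (2 : ℝ) • x i, fun h => Cadlag.two_smul_ne ⟨t, hj⟩ (congrFun h j), t, ht, ?_⟩
  exact mem_iUnion.2 ⟨j, (x j).disc_two_smul hj⟩

end SummationMap

/-! ### Polar coordinates and continuity of the map `(y, w) ↦ y w`. -/

section Polar

variable {a b : ℝ} {ℓ : ℕ}

/-- Scalar multiplication is jointly `J₁`-continuous. -/
theorem Cadlag.continuousAt_smul (r : ℝ) {x : Cadlag a b} {K : ℝ} (hK : ∀ t, |x t| ≤ K) :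
    ContinuousAt (fun z : ℝ × Cadlag a b => z.1 • z.2) (r, x) := by
  have hbound : ∀ (r' : ℝ) (x' : Cadlag a b) (δ : ℝ), 0 ≤ δ → dist x x' < min δ 1 →
      |r - r'| ≤ δ → dist (r • x) (r' • x') ≤ δ + (δ * |K| + |r'| * δ) := by
    intro r' x' δ hδ hx hr
    obtain ⟨f, h1, h2⟩ := Cadlag.exists_orderIso_of_dist_lt' hx
    refine Cadlag.dist_le_of_orderIso (by positivity) f (fun t => (h1 t).trans ?_) fun t => ?_
    · have : 0 ≤ δ * |K| + |r'| * δ := by positivity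
      linarith
    · simp only [Cadlag.smul_apply]
      -- The time change for `x` is kept. The first term is controlled by the bound on `x`, the
      -- second by the closeness of `x'` to `x`.
      have e : r * x t - r' * x' (f t) = (r - r') * x t + r' * (x t - x' (f t)) := by ring
      rw [e]
      refine (abs_add_le _ _).trans ?_
      rw [abs_mul, abs_mul]
      have e1 : |r - r'| * |x t| ≤ δ * |K| :=
        mul_le_mul hr ((hK t).trans (le_abs_self K)) (abs_nonneg _) hδ
      have e2 : |r'| * |x t - x' (f t)| ≤ |r'| * δ :=
        mul_le_mul_of_nonneg_left (h2 t) (abs_nonneg _)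
      linarith
  rw [Metric.continuousAt_iff]
  intro ε hε
  have hlim : Tendsto (fun δ : ℝ => δ + (δ * |K| + (|r| + 1) * δ)) (𝓝[>] 0) (𝓝 0) := by
    have : ContinuousAt (fun δ : ℝ => δ + (δ * |K| + (|r| + 1) * δ)) 0 := by fun_prop
    simpa using this.tendsto.mono_left nhdsWithin_le_nhds
  obtain ⟨δ, hδε, hδ0, hδ1⟩ := ((hlim.eventually (gt_mem_nhds hε)).and
    (Ioo_mem_nhdsGT (zero_lt_one' ℝ))).exists
  refine ⟨min δ 1, by positivity, fun {z} hz => ?_⟩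
  obtain ⟨hz1, hz2⟩ := max_lt_iff.1 (show max (dist z.1 r) (dist z.2 x) < _ from hz)
  rw [dist_comm] at hz1 hz2 ⊢
  rw [Real.dist_eq] at hz1
  have hr : |r - z.1| ≤ δ := hz1.le.trans (min_le_left _ _)
  refine (hbound z.1 z.2 δ hδ0.le hz2 hr).trans_lt (lt_of_le_of_lt ?_ hδε)
  have : |z.1| ≤ |r| + 1 := by
    have := abs_sub_abs_le_abs_sub z.1 r
    rw [abs_sub_comm] at this
    linarith
  gcongr

instance : SecondCountableTopology Radius :=
  Topology.IsInducing.secondCountableTopology (f := fun r : Radius => (r.1⁻¹).toReal) ⟨rfl⟩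

namespace PolarSpace

instance : SecondCountableTopology (PolarSpace a b ℓ) :=
  inferInstanceAs (SecondCountableTopology (Radius × CadlagSphere a b ℓ))

/-- The inverse of the radial coordinate. -/
noncomputable def invRadius (p : PolarSpace a b ℓ) : ℝ := (p.radius⁻¹).toReal

theorem continuous_invRadius : Continuous (invRadius (a := a) (b := b) (ℓ := ℓ)) := by
  have h : Continuous fun r : Radius => (r.1⁻¹).toReal := continuous_induced_dom
  exact h.comp (continuous_fst (X := Radius) (Y := CadlagSphere a b ℓ))

theorem continuous_angle : Continuous (angle (a := a) (b := b) (ℓ := ℓ)) :=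
  continuous_subtype_val.comp (continuous_snd (X := Radius) (Y := CadlagSphere a b ℓ))

theorem toReal_radius (p : PolarSpace a b ℓ) : p.radius.toReal = (p.invRadius)⁻¹ := by
  rw [invRadius, ENNReal.toReal_inv, inv_inv]

theorem invRadius_eq_zero {p : PolarSpace a b ℓ} : p.invRadius = 0 ↔ p.radius = ∞ := by
  rw [invRadius, ENNReal.toReal_eq_zero_iff, ENNReal.inv_eq_zero, ENNReal.inv_eq_top]
  exact or_iff_left p.1.2.ne'

theorem invRadius_eq_inv {p : PolarSpace a b ℓ} {ε : ℝ} (hε : 0 < ε) :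
    p.invRadius = ε⁻¹ ↔ p.radius = ENNReal.ofReal ε := by
  rw [invRadius, ENNReal.toReal_inv, inv_inj]
  refine ⟨fun h => ?_, fun h => by rw [h, ENNReal.toReal_ofReal hε.le]⟩
  rw [← h, ENNReal.ofReal_toReal]
  rintro h'
  rw [h', ENNReal.toReal_top] at h
  exact hε.ne h

/-- The metric is defined through `1 / r`, and in this coordinate the set is an open strip, with
radius `∞` at the excluded end `0`. -/
theorem truncSet_eq {ε : ℝ} (hε : 0 < ε) :
    truncSet a b ℓ ε = {p | 0 < p.invRadius ∧ p.invRadius < ε⁻¹} := by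
  ext p
  have hp : p.radius ≠ 0 := p.1.2.ne'
  simp only [truncSet, mem_ofPred_eq, invRadius]
  rcases eq_or_ne p.radius ∞ with h | h
  · simp [h]
  · have hpos : 0 < p.radius.toReal := ENNReal.toReal_pos hp h
    rw [ENNReal.toReal_inv, inv_lt_inv₀ hpos hε, ENNReal.ofReal_lt_iff_lt_toReal hε.le h]
    simp [hpos, lt_top_iff_ne_top, h]

theorem isOpen_truncSet {ε : ℝ} (hε : 0 < ε) : IsOpen (truncSet a b ℓ ε) := by
  rw [truncSet_eq hε]
  exact (isOpen_lt continuous_const continuous_invRadius).inter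
    (isOpen_lt continuous_invRadius continuous_const)

theorem isBounded_invRadius_lt (r : ℝ) :
    Bornology.IsBounded {p : PolarSpace a b ℓ | p.invRadius < r} := by
  refine Metric.isBounded_iff.2 ⟨max r 1, fun p hp q hq => ?_⟩
  refine max_le_max ?_ (CadlagVec.dist_le_one p.angle q.angle)
  have hp0 : 0 ≤ p.invRadius := ENNReal.toReal_nonneg
  have hq0 : 0 ≤ q.invRadius := ENNReal.toReal_nonneg
  have hp1 : p.invRadius < r := hp
  have hq1 : q.invRadius < r := hq
  change |p.invRadius - q.invRadius| ≤ _
  rw [abs_le]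
  constructor <;> linarith

theorem isBounded_truncSet {ε : ℝ} (hε : 0 < ε) : Bornology.IsBounded (truncSet a b ℓ ε) := by
  rw [truncSet_eq hε]
  exact (isBounded_invRadius_lt ε⁻¹).subset fun p hp => hp.2

theorem frontier_truncSet_subset {ε : ℝ} (hε : 0 < ε) : frontier (truncSet a b ℓ ε) ⊆
    {p | p.radius = ENNReal.ofReal ε ∨ p.radius = ∞} := by
  intro p hp
  rw [(isOpen_truncSet hε).frontier_eq] at hp
  obtain ⟨hpc, hpn⟩ := hp
  have hcl : p ∈ {p : PolarSpace a b ℓ | 0 ≤ p.invRadius ∧ p.invRadius ≤ ε⁻¹} := by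
    refine closure_minimal ?_ ((isClosed_le continuous_const continuous_invRadius).inter
      (isClosed_le continuous_invRadius continuous_const)) hpc
    rw [truncSet_eq hε]
    exact fun q hq => ⟨hq.1.le, hq.2.le⟩
  rw [truncSet_eq hε] at hpn
  change p.radius = ENNReal.ofReal ε ∨ p.radius = ∞
  rw [← invRadius_eq_zero, ← invRadius_eq_inv hε]
  by_contra! h
  exact hpn ⟨lt_of_le_of_ne hcl.1 h.2.symm, lt_of_le_of_ne hcl.2 h.1⟩

/-- The `i`-th coordinate of the point of `𝒟_I^ℓ` with polar coordinates `p`. -/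
noncomputable def coord (i : Fin ℓ) (p : PolarSpace a b ℓ) : Cadlag a b :=
  p.radius.toReal • p.angle i

theorem abs_angle_le_one (p : PolarSpace a b ℓ) (i : Fin ℓ) (t : Icc a b) :
    |p.angle i t| ≤ 1 := by
  have h : ‖p.angle i t‖ₑ ≤ 1 := by
    rw [← p.2.2]
    exact le_iSup_of_le i (le_iSup (fun t => ‖p.angle i t‖ₑ) t)
  rw [← Real.norm_eq_abs, ← toReal_enorm]
  exact ENNReal.toReal_le_of_le_ofReal zero_le_one (by simpa using h)

/-- The radius `toReal` takes the default value `0` at `∞` and is not continuous there. On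
`truncSet` the inverse radius is nonzero and can be inverted continuously. -/
theorem continuousOn_coord (i : Fin ℓ) {ε : ℝ} (hε : 0 < ε) :
    ContinuousOn (coord i) (truncSet a b ℓ ε) := by
  intro p hp
  rw [truncSet_eq hε] at hp
  refine ContinuousAt.continuousWithinAt ?_
  have h1 : ContinuousAt (fun q : PolarSpace a b ℓ => q.radius.toReal) p := by
    simp only [toReal_radius]
    exact continuous_invRadius.continuousAt.inv₀ hp.1.ne'
  have h2 : ContinuousAt (fun q : PolarSpace a b ℓ => q.angle i) p :=
    ((CadlagVec.continuous_apply i).comp continuous_angle).continuousAt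
  exact ContinuousAt.comp (f := fun q : PolarSpace a b ℓ => (q.radius.toReal, q.angle i))
    (Cadlag.continuousAt_smul p.radius.toReal (p.abs_angle_le_one i)) (h1.prodMk h2)

theorem measurable_coord_apply (i : Fin ℓ) (t : Icc a b) :
    Measurable fun p : PolarSpace a b ℓ => coord i p t := by
  simp only [coord, Cadlag.smul_apply, toReal_radius]
  exact continuous_invRadius.measurable.inv.mul ((Cadlag.measurable_eval t).comp
    ((CadlagVec.continuous_apply i).comp continuous_angle).measurable)

theorem disc_coord_subset (i : Fin ℓ) (p : PolarSpace a b ℓ) :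
    (coord i p).Disc ⊆ p.angle.Disc :=
  (Cadlag.disc_smul_subset _ _).trans (subset_iUnion (fun i => (p.angle i).Disc) i)

theorem truncSum_eq_restrictedSum (ε : ℝ) (m : Measure (PolarSpace a b ℓ)) (i : Fin ℓ) :
    truncSum ε m i = restrictedSum (truncSet a b ℓ ε) (coord i) m := rfl

end PolarSpace

end Polar

/-! ### Measurability for the Borel `σ`-field of the `w#` topology. -/

section Measurability

/-- The inner test functions converge to the indicator of an open set, so its mass is a limit of
`w#`-continuous functionals. -/
theorem BddFinMeasure.measurable_apply_of_isOpen {X : Type*} [MetricSpace X] [MeasurableSpace X]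
    [BorelSpace X] {A : Set X} (hA : IsOpen A) (hAb : Bornology.IsBounded A) :
    Measurable fun m : BddFinMeasure X => m.1 A := by
  have h : Measurable fun m : BddFinMeasure X => m.1.real A := by
    refine measurable_of_tendsto_metrizable (fun k => (BddFinMeasure.continuous_integral _
      (isBounded_support_innerTest hAb k)).measurable) (tendsto_pi_nhds.2 fun m => ?_)
    have := tendsto_integral_innerTest m hAb
    rwa [hA.interior_eq] at this
  have e : (fun m : BddFinMeasure X => m.1 A) = fun m => ENNReal.ofReal (m.1.real A) :=
    funext fun m => (ofReal_measureReal (m.measure_lt_top hAb).ne).symm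
  rw [e]
  exact h.ennreal_ofReal

theorem BddFinMeasure.measurable_restrict {X : Type*} [MetricSpace X] [MeasurableSpace X]
    [BorelSpace X] {U : Set X} (hUo : IsOpen U) (hU : Bornology.IsBounded U) :
    Measurable fun m : BddFinMeasure X => m.1.restrict U := by
  have : ∀ m : BddFinMeasure X, IsFiniteMeasure (m.1.restrict U) := fun m =>
    ⟨by rw [Measure.restrict_apply_univ]; exact m.measure_lt_top hU⟩
  have hopen : ∀ A : Set X, IsOpen A → Measurable fun m : BddFinMeasure X => m.1.restrict U A := by
    intro A hA
    simp only [Measure.restrict_apply hA.measurableSet]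
    exact measurable_apply_of_isOpen (hA.inter hUo) (hU.subset inter_subset_right)
  exact Measurable.measure_of_isPiSystem (BorelSpace.measurable_eq.trans rfl) isPiSystem_isOpen
    hopen (hopen univ isOpen_univ)

theorem aemeasurable_restrictedSum {a b : ℝ} {Ω X : Type*} [MeasurableSpace Ω] [MetricSpace X]
    [MeasurableSpace X] [BorelSpace X] [SecondCountableTopology X] {P : Measure Ω} {U : Set X}
    (hUo : IsOpen U) (hU : Bornology.IsBounded U) {c : X → Cadlag a b}
    (hc : ∀ t, Measurable fun p => c p t) {M : Ω → BddFinMeasure X} (hM : IsPointProcess P M) :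
    AEMeasurable (fun ω => restrictedSum U c (M ω).1) P := by
  classical
  -- The process takes values in point measures only almost surely, so the sum is replaced by `0`
  -- off a measurable set of full probability.
  obtain ⟨N, hNsub, hNm, hN⟩ : ∃ N : Set Ω, (∀ ω ∈ N, M ω ∈ pointMeasures X) ∧
      MeasurableSet N ∧ P Nᶜ = 0 := by
    obtain ⟨t, ht, htm, ht0⟩ := exists_measurable_superset_of_null (ae_iff.1 hM.2)
    exact ⟨tᶜ, fun ω hω => not_not.1 fun h => hω (ht h), htm.compl, by rwa [compl_compl]⟩
  have hκ := (BddFinMeasure.measurable_restrict hUo hU).comp hM.1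
  refine ⟨fun ω => if ω ∈ N then restrictedSum U c (M ω).1 else 0, ?_, ?_⟩
  · refine Cadlag.measurable_of_eval fun t => ?_
    have hY : Measurable fun ω => (∫⁻ p, ENNReal.ofReal (c p t) ∂(M ω).1.restrict U).toReal -
        (∫⁻ p, ENNReal.ofReal (-c p t) ∂(M ω).1.restrict U).toReal :=
      (((Measure.measurable_lintegral (hc t).ennreal_ofReal).comp hκ).ennreal_toReal).sub
        (((Measure.measurable_lintegral (hc t).neg.ennreal_ofReal).comp hκ).ennreal_toReal)
    convert! hY.indicator hNm using 1
    funext ω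
    by_cases hω : ω ∈ N
    · have h := restrictedSum_apply c hUo.measurableSet hU (hNsub ω hω) t
      rw [if_pos hω, indicator_of_mem hω]
      rw [h.2, integral_eq_lintegral_pos_part_sub_lintegral_neg_part h.1]
    · rw [if_neg hω, indicator_of_notMem hω, Cadlag.zero_apply]
  · have : ∀ᵐ ω ∂P, ω ∈ N := by rwa [ae_iff]
    filter_upwards [this] with ω hω
    rw [if_pos hω]

end Measurability

/-! ### Moments of a Poisson process and absence of related atoms. -/

section Poisson

/-- Termwise, `(n + 1) π{n + 1} = r π{n}` for the Poisson weights `π`. The choices `g = 1` and `g n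
= n` yield the first two moments. -/
theorem lintegral_natCast_mul_poissonMeasure (r : ℝ≥0) (g : ℕ → ℝ≥0∞) :
    ∫⁻ n, n * g n ∂(poissonMeasure r) = r * ∫⁻ n, g (n + 1) ∂(poissonMeasure r) := by
  rw [lintegral_countable', lintegral_countable', tsum_eq_zero_add' ENNReal.summable,
    ← ENNReal.tsum_mul_left]
  simp only [Nat.cast_zero, zero_mul, zero_add]
  refine tsum_congr fun n => ?_
  have h : ((n + 1 : ℕ) : ℝ≥0∞) * poissonMeasure r {n + 1} = r * poissonMeasure r {n} := by
    rw [poissonMeasure_singleton, poissonMeasure_singleton, ← ENNReal.ofReal_natCast,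
      ← ENNReal.ofReal_mul (by positivity), ← ENNReal.ofReal_coe_nnreal (p := r),
      ← ENNReal.ofReal_mul (by positivity), Nat.factorial_succ]
    congr 1
    push_cast
    field_simp
    ring
  rw [mul_right_comm, h]
  ring

theorem lintegral_natCast_poissonMeasure (r : ℝ≥0) :
    ∫⁻ n, (n : ℝ≥0∞) ∂(poissonMeasure r) = r := by
  simpa using lintegral_natCast_mul_poissonMeasure r 1

theorem lintegral_natCast_sq_poissonMeasure (r : ℝ≥0) :
    ∫⁻ n, (n : ℝ≥0∞) * n ∂(poissonMeasure r) = r * r + r := by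
  rw [lintegral_natCast_mul_poissonMeasure]
  push_cast
  rw [lintegral_add_left .of_discrete, lintegral_natCast_poissonMeasure]
  simp [mul_add]

variable {Ω X : Type*} [MeasurableSpace Ω] [MetricSpace X] [MeasurableSpace X] [BorelSpace X]
  {P : Measure Ω} {M : Ω → BddFinMeasure X} {μ : BddFinMeasure X} {U : Set X}

theorem measurable_apply_of_subset (hM : Measurable M) (hUo : IsOpen U)
    (hU : Bornology.IsBounded U) {A : Set X} (hA : MeasurableSet A) (hAU : A ⊆ U) :
    Measurable fun ω => (M ω).1 A := by
  have h := (Measure.measurable_coe hA).comp ((BddFinMeasure.measurable_restrict hUo hU).comp hM)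
  have e : (fun ω => (M ω).1 A) = fun ω => (M ω).1.restrict U A := funext fun ω => by
    rw [Measure.restrict_apply hA, inter_eq_left.2 hAU]
  rw [e]
  exact h

/-- The mass of `A` is almost surely a natural number, recovered as the floor of its real value, so
its law is determined by the probabilities of single values. -/
theorem IsPoissonProcess.lintegral_comp (h : IsPoissonProcess P M μ) (hUo : IsOpen U)
    (hU : Bornology.IsBounded U) {A : Set X} (hA : MeasurableSet A) (hAU : A ⊆ U)
    (g : ℝ≥0∞ → ℝ≥0∞) :
    ∫⁻ ω, g ((M ω).1 A) ∂P = ∫⁻ n : ℕ, g n ∂(poissonMeasure (μ.1 A).toNNReal) := by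
  have hm := measurable_apply_of_subset h.1.1 hUo hU hA hAU
  have hK : Measurable fun ω => ⌊((M ω).1 A).toReal⌋₊ := Nat.measurable_floor.comp hm.ennreal_toReal
  have hae : ∀ᵐ ω ∂P, (M ω).1 A = (⌊((M ω).1 A).toReal⌋₊ : ℝ≥0∞) := by
    filter_upwards [h.1.2] with ω hω
    obtain ⟨k, hk⟩ := hω A hA (hU.subset hAU)
    rw [hk, ENNReal.toReal_natCast, Nat.floor_natCast]
  have hlaw : P.map (fun ω => ⌊((M ω).1 A).toReal⌋₊) = poissonMeasure (μ.1 A).toNNReal := by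
    refine Measure.ext_of_singleton fun k => ?_
    rw [Measure.map_apply hK (measurableSet_singleton k), ← h.2.1 A hA (hU.subset hAU) k]
    refine measure_congr ?_
    filter_upwards [hae] with ω hω
    refine propext ⟨fun h' => ?_, fun h' => ?_⟩
    · change (M ω).1 A = k
      rw [hω]
      exact congrArg Nat.cast h'
    · change ⌊((M ω).1 A).toReal⌋₊ = k
      rw [show (M ω).1 A = k from h', ENNReal.toReal_natCast, Nat.floor_natCast]
  rw [← hlaw, lintegral_map .of_discrete hK]
  refine lintegral_congr_ae ?_
  filter_upwards [hae] with ω hω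
  rw [← hω]

theorem IsPoissonProcess.lintegral_apply (h : IsPoissonProcess P M μ) (hUo : IsOpen U)
    (hU : Bornology.IsBounded U) {A : Set X} (hA : MeasurableSet A) (hAU : A ⊆ U) :
    ∫⁻ ω, (M ω).1 A ∂P = μ.1 A := by
  rw [h.lintegral_comp hUo hU hA hAU fun x => x,
    lintegral_natCast_poissonMeasure, ENNReal.coe_toNNReal (μ.measure_lt_top (hU.subset hAU)).ne]

theorem IsPoissonProcess.lintegral_apply_sq (h : IsPoissonProcess P M μ) (hUo : IsOpen U)
    (hU : Bornology.IsBounded U) {A : Set X} (hA : MeasurableSet A) (hAU : A ⊆ U) :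
    ∫⁻ ω, (M ω).1 A * (M ω).1 A ∂P = μ.1 A * μ.1 A + μ.1 A := by
  rw [h.lintegral_comp hUo hU hA hAU fun x => x * x,
    lintegral_natCast_sq_poissonMeasure,
    ENNReal.coe_toNNReal (μ.measure_lt_top (hU.subset hAU)).ne]

theorem IsPoissonProcess.lintegral_mul_of_disjoint (h : IsPoissonProcess P M μ) (hUo : IsOpen U)
    (hU : Bornology.IsBounded U) {A B : Set X} (hA : MeasurableSet A) (hAU : A ⊆ U)
    (hB : MeasurableSet B) (hBU : B ⊆ U) (hAB : Disjoint A B) :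
    ∫⁻ ω, (M ω).1 A * (M ω).1 B ∂P = μ.1 A * μ.1 B := by
  have hind := h.2.2 2 ![A, B] (by simp [Fin.forall_fin_two, hA, hB])
    (by simp [Fin.forall_fin_two, hU.subset hAU, hU.subset hBU]) (by
      intro i j hij
      fin_cases i <;> fin_cases j <;> simp_all [disjoint_comm])
  have h2 := hind.indepFun (show (0 : Fin 2) ≠ 1 by decide)
  simp only [Matrix.cons_val_zero, Matrix.cons_val_one] at h2
  have h3 := lintegral_mul_eq_lintegral_mul_lintegral_of_indepFun
    (measurable_apply_of_subset h.1.1 hUo hU hA hAU)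
    (measurable_apply_of_subset h.1.1 hUo hU hB hBU) h2
  rw [h.lintegral_apply hUo hU hA hAU, h.lintegral_apply hUo hU hB hBU] at h3
  exact h3

/-- The masses of `A \ B`, `A ∩ B` and `B \ A` are pairwise independent. All products of distinct
pieces factor, and the square of the mass of `A ∩ B` contributes the extra term. -/
theorem IsPoissonProcess.lintegral_mul (h : IsPoissonProcess P M μ) (hUo : IsOpen U)
    (hU : Bornology.IsBounded U) {A B : Set X} (hA : MeasurableSet A) (hAU : A ⊆ U)
    (hB : MeasurableSet B) (hBU : B ⊆ U) :
    ∫⁻ ω, (M ω).1 A * (M ω).1 B ∂P = μ.1 A * μ.1 B + μ.1 (A ∩ B) := by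
  have hA' := hA.diff hB
  have hB' := hB.diff hA
  have hC := hA.inter hB
  have hA'U : A \ B ⊆ U := sdiff_subset.trans hAU
  have hB'U : B \ A ⊆ U := sdiff_subset.trans hBU
  have hCU : A ∩ B ⊆ U := inter_subset_left.trans hAU
  have mA' := measurable_apply_of_subset h.1.1 hUo hU hA' hA'U
  have mB' := measurable_apply_of_subset h.1.1 hUo hU hB' hB'U
  have mC := measurable_apply_of_subset h.1.1 hUo hU hC hCU
  have dAC : Disjoint (A \ B) (A ∩ B) := disjoint_sdiff_inter
  have dCB : Disjoint (A ∩ B) (B \ A) := by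
    rw [inter_comm]; exact disjoint_sdiff_inter.symm
  have dAB : Disjoint (A \ B) (B \ A) := disjoint_sdiff_sdiff
  have eA : ∀ ν : Measure X, ν A = ν (A \ B) + ν (A ∩ B) := fun ν =>
    (measure_sdiff_add_inter A hB).symm
  have eB : ∀ ν : Measure X, ν B = ν (B \ A) + ν (A ∩ B) := fun ν => by
    rw [inter_comm]; exact (measure_sdiff_add_inter B hA).symm
  have expand : ∀ ω, (M ω).1 A * (M ω).1 B = (M ω).1 (A \ B) * (M ω).1 (B \ A) +
      ((M ω).1 (A \ B) * (M ω).1 (A ∩ B) + ((M ω).1 (A ∩ B) * (M ω).1 (B \ A) +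
        (M ω).1 (A ∩ B) * (M ω).1 (A ∩ B))) := fun ω => by
    rw [eA, eB]; ring
  simp only [expand]
  rw [lintegral_add_left (by fun_prop), lintegral_add_left (by fun_prop),
    lintegral_add_left (by fun_prop), h.lintegral_mul_of_disjoint hUo hU hA' hA'U hB' hB'U dAB,
    h.lintegral_mul_of_disjoint hUo hU hA' hA'U hC hCU dAC,
    h.lintegral_mul_of_disjoint hUo hU hC hCU hB' hB'U dCB,
    h.lintegral_apply_sq hUo hU hC hCU, eA, eB]
  ring

theorem IsPoissonProcess.ae_apply_eq_zero (h : IsPoissonProcess P M μ) (hUo : IsOpen U)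
    (hU : Bornology.IsBounded U) {A : Set X} (hAU : A ⊆ U) (h0 : μ.1 A = 0) :
    ∀ᵐ ω ∂P, (M ω).1 A = 0 := by
  -- As `A` need not be measurable, a measurable hull inside `U` is used; its expected mass is zero.
  have hmeas := (measurableSet_toMeasurable μ.1 A).inter hUo.measurableSet
  have h1 := h.lintegral_apply hUo hU hmeas inter_subset_right
  rw [measure_mono_null inter_subset_left ((measure_toMeasurable A).trans h0),
    lintegral_eq_zero_iff (measurable_apply_of_subset h.1.1 hUo hU hmeas inter_subset_right)] at h1
  filter_upwards [h1] with ω hω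
  exact measure_mono_null (subset_inter (subset_toMeasurable μ.1 A) hAU) hω

/-- If a measurable relation is null for `μ ⊗ μ`, then almost surely no two atoms of a Poisson
process with mean measure `μ` are related. -/
theorem IsPoissonProcess.ae_pairwise_notMem [SecondCountableTopology X] [IsProbabilityMeasure P]
    (h : IsPoissonProcess P M μ) (hUo : IsOpen U) (hU : Bornology.IsBounded U)
    {R : Set (X × X)} (hR : MeasurableSet R)
    (hnull : (μ.1.restrict U).prod (μ.1.restrict U) R = 0) :
    ∀ᵐ ω ∂P, ∀ (n : ℕ) (z : Fin n → X), (M ω).1.restrict U = ∑ i, Measure.dirac (z i) →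
      Pairwise fun i j => (z i, z j) ∉ R := by
  have hUm := hUo.measurableSet
  have hfin : ∀ m : BddFinMeasure X, IsFiniteMeasure (m.1.restrict U) := fun m =>
    ⟨by rw [Measure.restrict_apply_univ]; exact m.measure_lt_top hU⟩
  have hdiag : Measurable fun x : X => (x, x) := measurable_id.prodMk measurable_id
  have hκ := (BddFinMeasure.measurable_restrict hUo hU).comp h.1.1
  have hmul : ∀ A B : Set X, MeasurableSet A → MeasurableSet B →
      Measurable fun ω => ((M ω).1.restrict U).prod ((M ω).1.restrict U) (A ×ˢ B) := by
    intro A B hA hB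
    simp only [Measure.prod_prod]
    exact ((Measure.measurable_coe hA).comp hκ).mul ((Measure.measurable_coe hB).comp hκ)
  have hprod : Measurable fun ω => ((M ω).1.restrict U).prod ((M ω).1.restrict U) := by
    refine Measurable.measure_of_isPiSystem generateFrom_prod.symm isPiSystem_prod ?_ ?_
    · rintro _ ⟨A, hA, B, hB, rfl⟩
      exact hmul A B hA hB
    · rw [← univ_prod_univ]
      exact hmul _ _ MeasurableSet.univ MeasurableSet.univ
  -- Second moment identity `E[M ⊗ M] = μ ⊗ μ` plus the diagonal image of `μ`, all restricted to
  -- `U`; it is enough to check it on rectangles.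
  have hmoment : (μ.1.restrict U).prod (μ.1.restrict U) +
      (μ.1.restrict U).map (fun x => (x, x)) =
      P.bind fun ω => ((M ω).1.restrict U).prod ((M ω).1.restrict U) := by
    have : IsFiniteMeasure ((μ.1.restrict U).map fun x => (x, x)) := Measure.isFiniteMeasure_map _ _
    refine Measure.ext_prod fun {A B} hA hB => ?_
    rw [Measure.bind_apply (hA.prod hB) hprod.aemeasurable, Measure.add_apply,
      Measure.map_apply hdiag (hA.prod hB)]
    simp only [Measure.prod_prod, Measure.restrict_apply hA, Measure.restrict_apply hB]
    rw [h.lintegral_mul hUo hU (hA.inter hUm) inter_subset_right (hB.inter hUm) inter_subset_right,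
      Measure.restrict_apply (hdiag (hA.prod hB))]
    congr 2
    ext x
    simp only [mem_inter_iff, mem_preimage, mem_prod]
    tauto
  have hD := hdiag hR
  have e1 : ∫⁻ ω, ((M ω).1.restrict U).prod ((M ω).1.restrict U) R ∂P =
      μ.1 ((fun x => (x, x)) ⁻¹' R ∩ U) := by
    rw [← Measure.bind_apply hR hprod.aemeasurable, ← hmoment, Measure.add_apply, hnull, zero_add,
      Measure.map_apply hdiag hR, Measure.restrict_apply hD]
  have e2 := h.lintegral_apply hUo hU (hD.inter hUm) inter_subset_right
  have hval : ∀ (m : BddFinMeasure X) (n : ℕ) (z : Fin n → X),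
      m.1.restrict U = ∑ i, Measure.dirac (z i) →
      (m.1.restrict U).prod (m.1.restrict U) R = ∑ i, ∑ j, R.indicator 1 (z i, z j) ∧
      m.1 ((fun x => (x, x)) ⁻¹' R ∩ U) = ∑ i, R.indicator 1 (z i, z i) := by
    intro m n z hz
    constructor
    · have := hfin m
      rw [Measure.prod_apply hR]
      simp only [hz]
      rw [lintegral_finsetSum_measure]
      refine Finset.sum_congr rfl fun i _ => ?_
      rw [lintegral_dirac, sum_dirac_apply z (measurable_prodMk_left hR)]
      rfl
    · rw [← Measure.restrict_apply hD, hz, sum_dirac_apply z hD]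
      rfl
  -- The diagonal pairs `(z i, z i)` in `R` are among all pairs in `R`. Both counts have the same
  -- finite expectation because `R` is `μ ⊗ μ`-null, so they agree almost surely and no pair `i ≠ j`
  -- contributes, even when `z i = z j`.
  have hle : (fun ω => (M ω).1 ((fun x => (x, x)) ⁻¹' R ∩ U)) ≤ᵐ[P]
      fun ω => ((M ω).1.restrict U).prod ((M ω).1.restrict U) R := by
    filter_upwards [h.1.2] with ω hω
    obtain ⟨n, z, hz⟩ := exists_restrict_eq_sum_dirac hUm hU hω
    obtain ⟨h1, h2⟩ := hval (M ω) n z hz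
    rw [h1, h2]
    exact Finset.sum_le_sum fun i _ =>
      Finset.single_le_sum (f := fun j => R.indicator (1 : X × X → ℝ≥0∞) (z i, z j))
        (fun _ _ => zero_le) (Finset.mem_univ i)
  have heq := ae_eq_of_ae_le_of_lintegral_le hle
    (by rw [e2]; exact (μ.measure_lt_top (hU.subset inter_subset_right)).ne)
    ((Measure.measurable_coe hR).comp hprod).aemeasurable (e1.trans e2.symm).le
  filter_upwards [heq] with ω hω n z hz i j hij hRij
  obtain ⟨h1, h2⟩ := hval (M ω) n z hz
  rw [h1, h2] at hω
  have hsplit : ∀ i, ∑ j, R.indicator (1 : X × X → ℝ≥0∞) (z i, z j) = R.indicator 1 (z i, z i) +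
      ∑ j ∈ Finset.univ.erase i, R.indicator 1 (z i, z j) := fun i =>
    (Finset.add_sum_erase _ _ (Finset.mem_univ i)).symm
  simp only [hsplit, Finset.sum_add_distrib] at hω
  have hne : ∑ i, R.indicator (1 : X × X → ℝ≥0∞) (z i, z i) ≠ ∞ :=
    ENNReal.sum_ne_top.2 fun i _ => by
      by_cases hi : (z i, z i) ∈ R <;> simp [hi]
  have hzero := (ENNReal.add_right_inj hne).1 ((add_zero _).trans hω)
  have h3 := Finset.sum_eq_zero_iff.1 hzero.symm i (Finset.mem_univ i)
  have h4 := Finset.sum_eq_zero_iff.1 h3 j (Finset.mem_erase.2 ⟨hij.symm, Finset.mem_univ j⟩)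
  rw [indicator_of_mem hRij] at h4
  exact one_ne_zero h4

end Poisson

/-! ### Discontinuity sets: countability, and measurability of having a common discontinuity. -/

namespace Cadlag

variable {a b : ℝ}

/-- A càdlàg function has at most countably many discontinuities. -/
theorem countable_disc (x : Cadlag a b) : x.Disc.Countable := by
  rcases lt_or_ge b a with hba | hab
  · have : IsEmpty (Icc a b) := ⟨fun t => absurd (t.2.1.trans t.2.2) (not_le.2 hba)⟩
    exact Set.to_countable _
  have key : ∀ ε : ℝ, 0 < ε → {t : Icc a b | ∃ᶠ s in 𝓝 t, ε < |x s - x t|}.Countable := by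
    intro ε hε
    set D := {t : Icc a b | ∃ᶠ s in 𝓝 t, ε < |x s - x t|} with hD
    have h : (D ∩ Iio ⟨b, right_mem_Icc.2 hab⟩).Countable := by
      -- Inside `(p, q)` the oscillation is at most `ε`, so passing from `p` to `q` adds at most the
      -- point `p` to the set.
      refine Icc_induction (H := fun p => (D ∩ Iio p).Countable) hab ?_ ?_
        (x.eventually_osc_left hε) (x.eventually_osc_right hε)
      · refine countable_empty.mono fun t ht => absurd t.2.1 (not_le.2 ht.2)
      · intro p q hpq hg hp
        refine (hp.union (countable_singleton p)).mono fun t ht => ?_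
        rcases lt_trichotomy t p with h | h | h
        · exact Or.inl ⟨ht.1, h⟩
        · exact Or.inr h
        · exfalso
          refine ht.1 ?_
          filter_upwards [Ioo_mem_nhds h ht.2] with s hs
          exact not_lt.2 (hg s t hs.1.le hs.2 h.le ht.2)
    refine (h.union (countable_singleton (⟨b, right_mem_Icc.2 hab⟩ : Icc a b))).mono fun t ht => ?_
    rcases eq_or_lt_of_le (show t ≤ ⟨b, right_mem_Icc.2 hab⟩ from t.2.2) with h | h
    · exact Or.inr h
    · exact Or.inl ⟨ht, h⟩
  refine (countable_iUnion fun k : ℕ => key (1 / ((k : ℝ) + 1)) (by positivity)).mono fun t ht => ?_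
  by_contra hn
  simp only [mem_iUnion, mem_ofPred_eq, not_exists, not_frequently, not_lt] at hn
  refine ht (Metric.continuousAt_iff'.2 fun ε hε => ?_)
  obtain ⟨k, hk⟩ := exists_nat_one_div_lt hε
  filter_upwards [hn k] with s hs
  rw [Real.dist_eq]
  exact hs.trans_lt hk

/-- Having a common discontinuity means having large increments over common arbitrarily short
intervals, the end points of which can be taken in a dense set. -/
theorem disc_inter_nonempty_iff (x y : Cadlag a b) {S : Set (Icc a b)} (hS : Dense S)
    (hSb : ∀ t : Icc a b, (t : ℝ) = b → t ∈ S) :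
    (x.Disc ∩ y.Disc).Nonempty ↔ ∃ k : ℕ, ∀ n : ℕ, ∃ u ∈ S, ∃ v ∈ S,
      dist u v < 1 / ((n : ℝ) + 1) ∧ 1 / ((k : ℝ) + 1) < |x u - x v| ∧
        1 / ((k : ℝ) + 1) < |y u - y v| := by
  constructor
  · rintro ⟨t, hx, hy⟩
    have hjump : ∀ z : Cadlag a b, t ∈ z.Disc → ∃ l : ℝ, l ≠ z t ∧ Tendsto z (𝓝[<] t) (𝓝 l) := by
      intro z hz
      obtain ⟨l, hl⟩ := (z.isCadlag t).2
      refine ⟨l, ?_, hl⟩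
      rintro rfl
      refine hz ?_
      rw [ContinuousAt, ← nhdsLT_sup_nhdsGE]
      exact hl.sup (z.isCadlag t).1
    obtain ⟨l, hlx, hl⟩ := hjump x hx
    obtain ⟨l', hly, hl'⟩ := hjump y hy
    -- If nothing lay to the left of `t`, right-continuity would be continuity at `t`.
    have hbot : (𝓝[<] t).NeBot := by
      by_contra hb
      rw [not_neBot] at hb
      refine hx ?_
      rw [ContinuousAt, ← nhdsLT_sup_nhdsGE, hb, bot_sup_eq]
      exact (x.isCadlag t).1
    obtain ⟨k, hk⟩ := exists_nat_one_div_lt (show 0 < min |l - x t| |l' - y t| from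
      lt_min (abs_pos.2 (sub_ne_zero.2 hlx)) (abs_pos.2 (sub_ne_zero.2 hly)))
    obtain ⟨hk1, hk2⟩ := lt_min_iff.1 hk
    refine ⟨k, fun n => ?_⟩
    have hpos : (0 : ℝ) < 1 / ((n : ℝ) + 1) / 2 := by positivity
    have hright : ∃ v ∈ S, dist t v < 1 / ((n : ℝ) + 1) / 2 ∧ 1 / ((k : ℝ) + 1) < |l - x v| ∧
        1 / ((k : ℝ) + 1) < |l' - y v| := by
      have ev : ∀ᶠ v in 𝓝[≥] t, dist t v < 1 / ((n : ℝ) + 1) / 2 ∧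
          1 / ((k : ℝ) + 1) < |l - x v| ∧ 1 / ((k : ℝ) + 1) < |l' - y v| := by
        refine Eventually.and ?_ (Eventually.and ?_ ?_)
        · filter_upwards [nhdsWithin_le_nhds (Metric.ball_mem_nhds t hpos)] with v hv
          rwa [dist_comm]
        · exact ((tendsto_const_nhds.sub (x.isCadlag t).1.tendsto).abs).eventually
            (lt_mem_nhds hk1)
        · exact ((tendsto_const_nhds.sub (y.isCadlag t).1.tendsto).abs).eventually
            (lt_mem_nhds hk2)
      -- A jump at `b` has no times to its right, so `v` must be `b` itself; this is why `S` has to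
      -- contain `b`.
      rcases eq_or_lt_of_le t.2.2 with htb | htb
      · exact ⟨t, hSb t htb, ev.self_of_nhdsWithin (mem_Ici.2 le_rfl)⟩
      · have htb' : t < ⟨b, t.2.1.trans t.2.2, le_rfl⟩ := htb
        obtain ⟨w, hw, hsub⟩ := (mem_nhdsGE_iff_exists_Ico_subset' htb').1 ev
        have hne : (Ioo t w).Nonempty := nonempty_Ioo.2 hw
        obtain ⟨v, hv, hvS⟩ := hS.inter_open_nonempty _ isOpen_Ioo hne
        exact ⟨v, hvS, hsub ⟨hv.1.le, hv.2⟩⟩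
    obtain ⟨v, hvS, hv1, hv2, hv3⟩ := hright
    have hleft : ∃ u ∈ S, dist u t < 1 / ((n : ℝ) + 1) / 2 ∧ 1 / ((k : ℝ) + 1) < |x u - x v| ∧
        1 / ((k : ℝ) + 1) < |y u - y v| := by
      have ev : ∀ᶠ u in 𝓝[<] t, dist u t < 1 / ((n : ℝ) + 1) / 2 ∧
          1 / ((k : ℝ) + 1) < |x u - x v| ∧ 1 / ((k : ℝ) + 1) < |y u - y v| := by
        refine Eventually.and ?_ (Eventually.and ?_ ?_)
        · exact nhdsWithin_le_nhds (Metric.ball_mem_nhds t hpos)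
        · exact ((hl.sub tendsto_const_nhds).abs).eventually (lt_mem_nhds hv2)
        · exact ((hl'.sub tendsto_const_nhds).abs).eventually (lt_mem_nhds hv3)
      obtain ⟨w₀, hw₀⟩ := hbot.nonempty_of_mem (self_mem_nhdsWithin (a := t) (s := Iio t))
      obtain ⟨w, hw, hsub⟩ := (mem_nhdsLT_iff_exists_Ioo_subset' hw₀).1 ev
      obtain ⟨u, hu, huS⟩ := hS.inter_open_nonempty _ isOpen_Ioo (nonempty_Ioo.2 hw)
      exact ⟨u, huS, hsub hu⟩
    obtain ⟨u, huS, hu1, hu2, hu3⟩ := hleft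
    refine ⟨u, huS, v, hvS, ?_, hu2, hu3⟩
    linarith [dist_triangle u t v]
  · rintro ⟨k, hk⟩
    choose u _ v _ huv hx hy using hk
    -- The intervals shrink to a point `t` along a subsequence. They are the same for `x` and `y`,
    -- so both functions are discontinuous at this one `t`.
    obtain ⟨t, -, φ, hφ, hut⟩ := isCompact_univ.tendsto_subseq (fun n => mem_univ (u n))
    have hd : Tendsto (fun n => dist (u (φ n)) (v (φ n))) atTop (𝓝 0) :=
      squeeze_zero (fun _ => dist_nonneg) (fun n => (huv (φ n)).le)
        (tendsto_one_div_add_atTop_nhds_zero_nat.comp hφ.tendsto_atTop)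
    have hvt : Tendsto (v ∘ φ) atTop (𝓝 t) := (tendsto_iff_of_dist hd).1 hut
    have hdisc : ∀ z : Cadlag a b, (∀ n, 1 / ((k : ℝ) + 1) < |z (u n) - z (v n)|) →
        t ∈ z.Disc := by
      intro z hz hc
      have h1 := ((hc.tendsto.comp hut).sub (hc.tendsto.comp hvt)).abs
      rw [sub_self, abs_zero] at h1
      have h2 : 1 / ((k : ℝ) + 1) ≤ 0 := ge_of_tendsto' h1 fun n => (hz (φ n)).le
      have h3 : 0 < 1 / ((k : ℝ) + 1) := by positivity
      linarith
    exact ⟨t, hdisc x hx, hdisc y hy⟩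

/-- With a countable dense set containing `b`, the increment criterion involves only countably many
evaluations. -/
theorem measurableSet_disc_inter_nonempty :
    MeasurableSet {z : Cadlag a b × Cadlag a b | (z.1.Disc ∩ z.2.Disc).Nonempty} := by
  obtain ⟨S₀, hS₀c, hS₀⟩ := TopologicalSpace.exists_countable_dense (Icc a b)
  let S : Set (Icc a b) := S₀ ∪ {t | (t : ℝ) = b}
  have hSc : S.Countable := hS₀c.union (Set.Subsingleton.countable fun s hs t ht =>
    Subtype.ext (Eq.trans hs (Eq.symm ht)))
  have hSd : Dense S := hS₀.mono subset_union_left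
  have hset : {z : Cadlag a b × Cadlag a b | (z.1.Disc ∩ z.2.Disc).Nonempty} =
      ⋃ k : ℕ, ⋂ n : ℕ, ⋃ u ∈ S, ⋃ v ∈ S, {z : Cadlag a b × Cadlag a b |
        dist u v < 1 / ((n : ℝ) + 1) ∧ 1 / ((k : ℝ) + 1) < |z.1 u - z.1 v| ∧
          1 / ((k : ℝ) + 1) < |z.2 u - z.2 v|} := by
    ext z
    simp only [mem_ofPred_eq, mem_iUnion, mem_iInter, exists_prop,
      disc_inter_nonempty_iff z.1 z.2 hSd fun t ht => Or.inr ht]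
  rw [hset]
  refine MeasurableSet.iUnion fun k => MeasurableSet.iInter fun n =>
    MeasurableSet.biUnion hSc fun u _ => MeasurableSet.biUnion hSc fun v _ => ?_
  have hm : ∀ t : Icc a b, Measurable fun z : Cadlag a b × Cadlag a b => z.1 t :=
    fun t => (measurable_eval t).comp measurable_fst
  have hm' : ∀ t : Icc a b, Measurable fun z : Cadlag a b × Cadlag a b => z.2 t :=
    fun t => (measurable_eval t).comp measurable_snd
  refine (MeasurableSet.const _).inter (MeasurableSet.inter ?_ ?_)
  · exact measurableSet_lt measurable_const ((hm u).sub (hm v)).abs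
  · exact measurableSet_lt measurable_const ((hm' u).sub (hm' v)).abs

end Cadlag

/-! ### Continuous mapping through a metrizable image. -/

section WeakConvergence

/-- A version of the continuous mapping theorem. The map `T` is only continuous along a continuous
map `J` into a metrizable space, within an almost sure set `S` and at almost every value of the
limit. -/
theorem tendstoInDistribution_of_ae_continuous {E F G ι : Type*} [TopologicalSpace E]
    [MeasurableSpace E] [OpensMeasurableSpace E] [TopologicalSpace F] [MeasurableSpace F]
    [BorelSpace F] [HasOuterApproxClosed F] [TopologicalSpace G] [MeasurableSpace G]
    [BorelSpace G] [HasOuterApproxClosed G] {l : Filter ι} [l.IsCountablyGenerated]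
    {Ω : ι → Type*} [∀ n, MeasurableSpace (Ω n)] {P : ∀ n, Measure (Ω n)}
    [∀ n, IsProbabilityMeasure (P n)] {Ω' : Type*} [MeasurableSpace Ω'] {P' : Measure Ω'}
    [IsProbabilityMeasure P'] {X : ∀ n, Ω n → E} {Z : Ω' → E}
    (hXZ : TendstoInDistribution X l Z P P') {S : Set E} (hS : ∀ n, ∀ᵐ ω ∂P n, X n ω ∈ S)
    {J : E → G} (hJ : Continuous J) {T : E → F}
    (hTX : ∀ n, AEMeasurable (fun ω => T (X n ω)) (P n))
    (hTZ : AEMeasurable (fun ω => T (Z ω)) P')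
    (hT : ∀ᵐ ω ∂P', Tendsto T (comap J (𝓝 (J (Z ω))) ⊓ 𝓟 S) (𝓝 (T (Z ω)))) :
    TendstoInDistribution (fun n ω => T (X n ω)) l (fun ω => T (Z ω)) P P' where
  forall_aemeasurable := hTX
  aemeasurable_limit := hTZ
  tendsto := by
    have hJXZ := hXZ.continuous_comp hJ
    refine tendsto_of_forall_isClosed_limsup_le' fun C hC => ?_
    -- The portmanteau inequality is applied to `J ∘ X n` and this closed set, which contains `J (X
    -- n ω)` almost surely whenever `T (X n ω) ∈ C`.
    have hG : IsClosed (closure (J '' (S ∩ T ⁻¹' C))) := isClosed_closure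
    refine le_trans (limsup_le_limsup (Eventually.of_forall fun n => ?_)) <|
      (ProbabilityMeasure.limsup_measure_closed_le_of_tendsto hJXZ.tendsto hG).trans ?_
    · change (P n).map (fun ω => T (X n ω)) C ≤ (P n).map (J ∘ X n) _
      rw [Measure.map_apply_of_aemeasurable (hTX n) hC.measurableSet,
        Measure.map_apply_of_aemeasurable (hJXZ.forall_aemeasurable n) hG.measurableSet]
      refine measure_mono_ae ?_
      filter_upwards [hS n] with ω hω h
      exact subset_closure ⟨X n ω, ⟨hω, h⟩, rfl⟩
    · change P'.map (J ∘ Z) _ ≤ P'.map (fun ω => T (Z ω)) C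
      rw [Measure.map_apply_of_aemeasurable hTZ hC.measurableSet,
        Measure.map_apply_of_aemeasurable hJXZ.aemeasurable_limit hG.measurableSet]
      refine measure_mono_ae ?_
      filter_upwards [hT] with ω hω h
      -- If `J (Z ω)` lies in the closure, the filter along which `T` converges to `T (Z ω)` meets
      -- `S ∩ T ⁻¹' C`, so the limit lies in the closed set `C`.
      have hne : (comap J (𝓝 (J (Z ω))) ⊓ 𝓟 (S ∩ T ⁻¹' C)).NeBot := by
        rw [← map_neBot_iff J, Filter.push_pull', map_principal]
        exact mem_closure_iff_clusterPt.1 h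
      have hle : comap J (𝓝 (J (Z ω))) ⊓ 𝓟 (S ∩ T ⁻¹' C) ≤ comap J (𝓝 (J (Z ω))) ⊓ 𝓟 S :=
        inf_le_inf_left _ (principal_mono.2 inter_subset_left)
      exact hC.mem_of_tendsto (hω.mono_left hle)
        (mem_inf_of_right (mem_principal.2 inter_subset_right))

end WeakConvergence

/-! ### Weak convergence of the truncated sums. -/

section TruncatedSum

variable {a b : ℝ} {ℓ : ℕ}

/-- By Fubini: for fixed `p`, the points `q` sharing a discontinuity with it lie in a countable
union of null sets, one for each discontinuity of `coord i p`. -/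
theorem PolarSpace.prod_disc_inter_eq_zero {ν : Measure (PolarSpace a b ℓ)} [IsFiniteMeasure ν]
    (hν : ∀ t : Icc a b, ν {p | t ∈ p.angle.Disc} = 0) (i : Fin ℓ) :
    MeasurableSet {z : PolarSpace a b ℓ × PolarSpace a b ℓ |
        ((coord i z.1).Disc ∩ (coord i z.2).Disc).Nonempty} ∧
      (ν.prod ν) {z | ((coord i z.1).Disc ∩ (coord i z.2).Disc).Nonempty} = 0 := by
  have hc : Measurable (coord (a := a) (b := b) i) :=
    Cadlag.measurable_of_eval fun t => measurable_coord_apply i t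
  have hm : MeasurableSet {z : PolarSpace a b ℓ × PolarSpace a b ℓ |
      ((coord i z.1).Disc ∩ (coord i z.2).Disc).Nonempty} :=
    ((hc.comp measurable_fst).prodMk (hc.comp measurable_snd))
      Cadlag.measurableSet_disc_inter_nonempty
  refine ⟨hm, (Measure.measure_prod_null hm).2 (Eventually.of_forall fun p => ?_)⟩
  refine measure_mono_null (t := ⋃ t ∈ (coord i p).Disc, {q | t ∈ q.angle.Disc}) ?_
    ((measure_biUnion_null_iff (coord i p).countable_disc).2 fun t _ => hν t)
  rintro q ⟨t, htp, htq⟩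
  exact mem_biUnion htp (disc_coord_subset i q htq)

theorem aemeasurable_truncSum {Ω : Type*} [MeasurableSpace Ω] {P : Measure Ω}
    {M : Ω → BddFinMeasure (PolarSpace a b ℓ)} (hM : IsPointProcess P M) {ε : ℝ} (hε : 0 < ε) :
    AEMeasurable (fun ω => truncSum ε (M ω).1) P := by
  have h : AEMeasurable (fun ω i => truncSum ε (M ω).1 i) P :=
    aemeasurable_pi_lambda _ fun i => aemeasurable_restrictedSum (PolarSpace.isOpen_truncSet hε)
      (PolarSpace.isBounded_truncSet hε) (PolarSpace.measurable_coord_apply i) hM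
  -- Coordinatewise measurability concerns the product `σ`-field, which equals the Borel one because
  -- `𝒟_I` is second countable.
  have hborel : (MeasurableSpace.pi : MeasurableSpace (Fin ℓ → Cadlag a b)) =
      borel (Fin ℓ → Cadlag a b) := BorelSpace.measurable_eq
  rw [hborel] at h
  exact h

theorem truncSum_apply {ε : ℝ} (hε : 0 < ε) {m : BddFinMeasure (PolarSpace a b ℓ)}
    (hm : m ∈ pointMeasures (PolarSpace a b ℓ)) (i : Fin ℓ) (t : Icc a b) :
    IntegrableOn (fun p : PolarSpace a b ℓ => p.radius.toReal * p.angle i t)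
        (truncSet a b ℓ ε) m.1 ∧
      truncSum ε m.1 i t = ∫ p in truncSet a b ℓ ε, p.radius.toReal * p.angle i t ∂m.1 :=
  restrictedSum_apply (PolarSpace.coord i) (PolarSpace.isOpen_truncSet hε).measurableSet
    (PolarSpace.isBounded_truncSet hε) hm t

variable {μ : BddFinMeasure (PolarSpace a b ℓ)} {ε : ℝ} {Ω' : Type*} [MeasurableSpace Ω']
  {P' : Measure Ω'} {M : Ω' → BddFinMeasure (PolarSpace a b ℓ)}

/-- A jump of the sum at `t` requires an atom in `truncSet` that jumps at `t`, and the expected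
number of such atoms is zero. -/
theorem ae_notMem_disc_truncSum (hε : 0 < ε) (hM : IsPoissonProcess P' M μ) (t : Icc a b)
    (ht : μ.1 {p | t ∈ p.angle.Disc} = 0) : ∀ᵐ ω ∂P', t ∉ (truncSum ε (M ω).1).Disc := by
  have hUo := PolarSpace.isOpen_truncSet (a := a) (b := b) (ℓ := ℓ) hε
  have hU := PolarSpace.isBounded_truncSet (a := a) (b := b) (ℓ := ℓ) hε
  filter_upwards [hM.1.2, hM.ae_apply_eq_zero hUo hU inter_subset_right
    (measure_mono_null inter_subset_left ht)] with ω hω h0 hmem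
  obtain ⟨n, z, hz⟩ := exists_restrict_eq_sum_dirac hUo.measurableSet hU hω
  obtain ⟨i, hi⟩ := mem_iUnion.1 hmem
  rw [PolarSpace.truncSum_eq_restrictedSum, restrictedSum_eq_sum hz] at hi
  obtain ⟨j, -, hj⟩ := mem_iUnion₂.1 (Cadlag.disc_sum_subset _ _ hi)
  have hsing : (M ω).1.restrict (truncSet a b ℓ ε) {z j} = 0 := by
    have hzU : z j ∈ truncSet a b ℓ ε := not_not.1 (notMem_of_sum_dirac_eq_zero
      hUo.measurableSet.compl (by
        rw [← hz, Measure.restrict_apply hUo.measurableSet.compl, compl_inter_self,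
          measure_empty]) j)
    rw [Measure.restrict_apply (measurableSet_singleton _)]
    refine measure_mono_null ?_ h0
    rintro p ⟨rfl, hp⟩
    exact ⟨PolarSpace.disc_coord_subset i _ hj, hp⟩
  rw [hz] at hsing
  exact notMem_of_sum_dirac_eq_zero (measurableSet_singleton _) hsing j rfl

theorem tendstoInDistribution_truncSum (hε : 0 < ε)
    (hdisc : ∀ t : Icc a b, μ.1 {p | t ∈ p.angle.Disc} = 0)
    (hend : μ.1 {p | p.radius = ENNReal.ofReal ε ∨ p.radius = ∞} = 0)
    {Ω : ℕ → Type*} [∀ n, MeasurableSpace (Ω n)] {P : ∀ n, Measure (Ω n)}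
    [∀ n, IsProbabilityMeasure (P n)] [IsProbabilityMeasure P']
    {Mn : ∀ n, Ω n → BddFinMeasure (PolarSpace a b ℓ)} (hMn : ∀ n, IsPointProcess (P n) (Mn n))
    (hM : IsPoissonProcess P' M μ) (hlim : TendstoInDistribution Mn atTop M P P') :
    TendstoInDistribution (fun n ω => truncSum ε (Mn n ω).1) atTop
      (fun ω => truncSum ε (M ω).1) P P' := by
  have hUo := PolarSpace.isOpen_truncSet (a := a) (b := b) (ℓ := ℓ) hε
  have hU := PolarSpace.isBounded_truncSet (a := a) (b := b) (ℓ := ℓ) hε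
  obtain ⟨B, hBb, hBo, hB0, hBs⟩ := exists_testSets hUo hU
  have hfin : IsFiniteMeasure (μ.1.restrict (truncSet a b ℓ ε)) :=
    ⟨by rw [Measure.restrict_apply_univ]; exact μ.measure_lt_top hU⟩
  have hnull := PolarSpace.prod_disc_inter_eq_zero (ν := μ.1.restrict (truncSet a b ℓ ε))
    fun t => le_antisymm ((Measure.restrict_le_self _).trans (hdisc t).le) zero_le
  have hpair := ae_all_iff.2 fun i => hM.ae_pairwise_notMem hUo hU (hnull i).1 (hnull i).2
  have hfr : ∀ᵐ ω ∂P', (M ω).1 (frontier (truncSet a b ℓ ε)) = 0 := by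
    -- The frontier lies outside `truncSet`, so a larger bounded open set is needed to contain it.
    refine hM.ae_apply_eq_zero (isOpen_lt PolarSpace.continuous_invRadius continuous_const)
      (PolarSpace.isBounded_invRadius_lt (ε⁻¹ + 1)) (fun p hp => ?_)
      (measure_mono_null (PolarSpace.frontier_truncSet_subset hε) hend)
    have hpos : 0 < ε⁻¹ := inv_pos.2 hε
    change p.invRadius < ε⁻¹ + 1
    rcases PolarSpace.frontier_truncSet_subset hε hp with h | h
    · rw [(PolarSpace.invRadius_eq_inv hε).2 h]; linarith
    · rw [PolarSpace.invRadius_eq_zero.2 h]; linarith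
  -- At almost every value of the Poisson limit, convergence of the test integrals within point
  -- measures forces convergence of the truncated sums.
  refine tendstoInDistribution_of_ae_continuous (T := fun m => truncSum ε m.1) hlim
    (fun n => (hMn n).2) (continuous_testIntegrals hBb) (fun n => aemeasurable_truncSum (hMn n) hε)
    (aemeasurable_truncSum hM.1 hε) ?_
  filter_upwards [hM.1.2, hpair, hfr] with ω hω hωpair hωfr
  obtain ⟨n, z, hz⟩ := exists_restrict_eq_sum_dirac hUo.measurableSet hU hω
  refine tendsto_pi_nhds.2 fun i => ?_
  exact tendsto_restrictedSum hUo hU (PolarSpace.continuousOn_coord i hε) hBb hBo hB0 hBs hω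
    (mem_inf_of_right (mem_principal_self _)) hωfr hz
    (fun j k hjk => disjoint_iff_inter_eq_empty.2
      (not_nonempty_iff_eq_empty.1 (hωpair i n z hz hjk)))
    (tendsto_comap.mono_left inf_le_left)

end TruncatedSum

theorem mainTheorem10 (a b : ℝ) (hab : a ≤ b) (ℓ : ℕ) (hℓ : 0 < ℓ) :
    -- the summation map on `𝒩(𝒟_I)`: it is well defined, and continuous on `𝒩*(𝒟_I)`
    ((∀ m ∈ pointMeasures (Cadlag a b), ∀ t,
        Integrable (fun w : Cadlag a b => w t) m.1 ∧ summation m.1 t = ∫ w, w t ∂m.1) ∧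
      ∀ m ∈ noCommonDisc (Cadlag.Disc (a := a) (b := b)),
        ContinuousAt (fun m : pointMeasures (Cadlag a b) => summation m.1.1) m) ∧
    -- the summation map on `𝒩(𝒟_I^ℓ)`: it is well defined, and continuous on `𝒩*(𝒟_I^ℓ)`
    ((∀ m ∈ pointMeasures (CadlagVec a b ℓ), ∀ i t,
        Integrable (fun w : CadlagVec a b ℓ => w i t) m.1 ∧
          summationVec m.1 i t = ∫ w, w i t ∂m.1) ∧
      ∀ m ∈ noCommonDisc (CadlagVec.Disc (a := a) (b := b) (ℓ := ℓ)),
        ContinuousAt (fun m : pointMeasures (CadlagVec a b ℓ) => summationVec m.1.1) m) ∧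
    -- the truncated sums of a point measure on `(0, ∞] × 𝒮_{I,ℓ}` are well defined
    (∀ ε : ℝ, 0 < ε → ∀ m ∈ pointMeasures (PolarSpace a b ℓ), ∀ i t,
      IntegrableOn (fun p : PolarSpace a b ℓ => p.radius.toReal * p.angle i t)
          (truncSet a b ℓ ε) m.1 ∧
        truncSum ε m.1 i t =
          ∫ p in truncSet a b ℓ ε, p.radius.toReal * p.angle i t ∂m.1) ∧
    -- weak convergence of the truncated sums; the limit has no fixed jump
    (∀ (μ : BddFinMeasure (PolarSpace a b ℓ)) (ε : ℝ), 0 < ε →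
      (∀ t : Icc a b, μ.1 {p | t ∈ p.angle.Disc} = 0) →
      μ.1 {p | p.radius = ENNReal.ofReal ε ∨ p.radius = ∞} = 0 →
      ∀ (Ω : ℕ → Type*) [∀ n, MeasurableSpace (Ω n)] (P : ∀ n, Measure (Ω n))
        [∀ n, IsProbabilityMeasure (P n)] (Ω' : Type*) [MeasurableSpace Ω'] (P' : Measure Ω')
        [IsProbabilityMeasure P']
        (Mn : ∀ n, Ω n → BddFinMeasure (PolarSpace a b ℓ))
        (M : Ω' → BddFinMeasure (PolarSpace a b ℓ)),
        (∀ n, IsPointProcess (P n) (Mn n)) →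
        IsPoissonProcess P' M μ →
        TendstoInDistribution Mn atTop M P P' →
        TendstoInDistribution (fun n ω => truncSum ε (Mn n ω).1) atTop
            (fun ω => truncSum ε (M ω).1) P P' ∧
          ∀ t : Icc a b, ∀ᵐ ω ∂P', t ∉ (truncSum ε (M ω).1).Disc) := by
  exact ⟨⟨fun m hm t => summation_apply hm t, fun m hm => continuousAt_summation hm⟩,
    ⟨fun m hm i t => summationVec_apply hm i t, fun m hm => continuousAt_summationVec hm⟩,
    fun ε hε m hm i t => truncSum_apply hε hm i t,
    fun μ ε hε hdisc hend Ω _ P _ Ω' _ P' _ Mn M hMn hM hlim =>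
      ⟨tendstoInDistribution_truncSum hε hdisc hend hMn hM hlim,
        fun t => ae_notMem_disc_truncSum hε hM t (hdisc t)⟩⟩
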